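/- **Definitions.** For a bounded interval $J$ and $\varphi\in L^1(J)$ let $\langle\varphi\rangle_J=\frac1{|J|}\int_J\varphi$. For $p\ge1$, let $\mathrm{BMO}^p((0,1))$ be the set of $\varphi\in L^1((0,1))$ with $$\|\varphi\|_{\mathrm{BMO}^p}:=\sup_{J}\,\big\langle|\varphi-\langle\varphi\rangle_J|^p\big\rangle_J^{1/p}<\infty,$$ where the supremum is over all subintervals $J$ of $(0,1)$, including $(0,1)$ itself. For $\varepsilon\ge0$ let $C(\varepsilon,p)\in[1,\infty]$ be the best (smallest) constant such that $$\langle e^{\varphi}\rangle_J\le C(\varepsilon,p)\,e^{\langle\varphi\rangle_J}$$ for all $\varphi\in\mathrm{BMO}^p((0,1))$ with $\|\varphi\|_{\mathrm{BMO}^p}\le\varepsilon$ and all subintervals $J$ of $(0,1)$. The John–Nirenberg constant $\varepsilon_0(p)$ of $\mathrm{BMO}^p((0,1))$ is the largest number such that $C(\varepsilon,p)<\infty$ for all $0\le\varepsilon<\varepsilon_0(p)$. For $C\ge1$ let $\xi^-(C)\le0\le\xi^+(C)<1$ be the unique solutions of $e^{-\xi}=C(1-\xi)$ in $(-\infty,0]$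 and in $[0,1)$, and let $$k(C)=2\,\frac{(1-\xi^-(C))(1-\xi^+(C))}{\xi^+(C)-\xi^-(C)}\,(C-1)\quad(C>1),\qquad k(1)=0.$$ **Theorem 1.1.** (i) For $1\le p\le2$, the John–Nirenberg constant is positive and finite, and $$\varepsilon_0(p)=\left[\frac pe\Big(\Gamma(p)-\int_0^1t^{p-1}e^t\,dt\Big)+1\right]^{1/p}.$$ (ii) For $1<p\le2$ and all $(2-p)\,\varepsilon_0(p)\le\varepsilon<\varepsilon_0(p)$, $$C(\varepsilon,p)=\frac{e^{-\varepsilon/\varepsilon_0(p)}}{1-\varepsilon/\varepsilon_0(p)}.$$ (iii) The function $k$ is a bijection from $[1,\infty)$ onto $[0,\frac2e)$, and, with $k^{-1}:[0,\frac2e)\to[1,\infty)$ its inverse, for all $0\le\varepsilon<\frac2e$, $$\frac{e^{-\frac e2\varepsilon}}{1-\frac e2\varepsilon}\le C(\varepsilon,1)\le k^{-1}(\varepsilon).$$ -/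

import Mathlib

open MeasureTheory Set
open scoped ENNReal

noncomputable section

namespace BMOUnitInterval

/-! ### The space BMO on the interval (0,1) -/

/-- The mean oscillation `(|J|⁻¹ ∫_J |φ - ⟨φ⟩_J|^p)^{1/p}` of `φ` over the interval `J = (a,b)`,
with values in `[0,∞]`. -/
def osc (p : ℝ) (φ : ℝ → ℝ) (a b : ℝ) : ℝ≥0∞ :=
  (⨍⁻ t in Ioo a b, ENNReal.ofReal (|φ t - ⨍ s in Ioo a b, φ s| ^ p) ∂volume) ^ (1 / p)

/-- The norm `‖φ‖_{BMO^p((0,1))}`: the supremum of the oscillations over all subintervals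
`(a,b)` of `(0,1)`, including `(0,1)` itself. -/
def bmoNorm (p : ℝ) (φ : ℝ → ℝ) : ℝ≥0∞ :=
  ⨆ (a : ℝ) (b : ℝ) (_ : 0 ≤ a) (_ : a < b) (_ : b ≤ 1), osc p φ a b

/-- `φ` belongs to `BMO^p((0,1))`. Only the restriction of `φ` to `(0,1)` matters. Integrability
on `(0,1)` is what gives a meaning to the averages over all subintervals, `(0,1)` included. -/
structure MemBMO (p : ℝ) (φ : ℝ → ℝ) : Prop where
  integrableOn : IntegrableOn φ (Ioo 0 1)
  norm_lt_top : bmoNorm p φ < ⊤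

/-! ### Best constants in the integral John-Nirenberg inequality -/

/-- `K` is an admissible constant at level `ε`: for all `φ ∈ BMO^p((0,1))` with norm at most `ε`
and all subintervals `J = (a,b)` of `(0,1)` one has `⟨e^φ⟩_J ≤ K e^{⟨φ⟩_J}`. -/
def IsJNBound (p ε : ℝ) (K : ℝ≥0∞) : Prop :=
  ∀ φ : ℝ → ℝ, MemBMO p φ → bmoNorm p φ ≤ ENNReal.ofReal ε →
    ∀ a b : ℝ, 0 ≤ a → a < b → b ≤ 1 →
      (⨍⁻ t in Ioo a b, ENNReal.ofReal (Real.exp (φ t)) ∂volume) ≤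
        K * ENNReal.ofReal (Real.exp (⨍ t in Ioo a b, φ t))

/-- The best constant `C(ε,p)`; it is `∞` if no finite constant is admissible. -/
def bestConst (ε p : ℝ) : ℝ≥0∞ :=
  sInf {K : ℝ≥0∞ | IsJNBound p ε K}

/-- The John-Nirenberg constant `ε₀(p)`: the largest `e ∈ [0,∞]` such that for each
`0 ≤ ε < e` the inequality holds with some finite constant. -/
def jnConst (p : ℝ) : ℝ≥0∞ :=
  sSup {e : ℝ≥0∞ | ∀ ε : ℝ, 0 ≤ ε → ENNReal.ofReal ε < e → ∃ K : ℝ≥0∞, K < ⊤ ∧ IsJNBound p ε K}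

/-! ### The functions `ξ⁺`, `ξ⁻` and `k` -/

/-- For `C ≥ 1` there is exactly one solution of `e^{-ξ} = C (1 - ξ)` with `0 ≤ ξ < 1`. -/
theorem existsUnique_xiPlus {C : ℝ} (hC : 1 ≤ C) :
    ∃! ξ : ℝ, 0 ≤ ξ ∧ ξ < 1 ∧ Real.exp (-ξ) = C * (1 - ξ) := by
  have key : ∀ x y : ℝ, 0 ≤ x → x < y → Real.exp (-x) = C * (1 - x) →
      Real.exp (-y) = C * (1 - y) → False := by
    intro x y hx hxy ex ey
    have h1 : x - y + 1 < Real.exp (x - y) := Real.add_one_lt_exp (by linarith)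
    have h2 : Real.exp (-y) = Real.exp (x - y) * Real.exp (-x) := by
      rw [← Real.exp_add]; ring_nf
    have h3 : 0 < Real.exp (-x) := Real.exp_pos _
    have h4 : (x - y + 1) * Real.exp (-x) < Real.exp (-y) := by
      rw [h2]; exact mul_lt_mul_of_pos_right h1 h3
    rw [ex, ey] at h4
    have h5 : 0 ≤ C * (x * (y - x)) := by
      have : 0 ≤ y - x := by linarith
      positivity
    nlinarith
  have hcont : ContinuousOn (fun x : ℝ => Real.exp (-x) - C * (1 - x)) (Icc 0 1) := by fun_prop
  have hmem : (0 : ℝ) ∈ Icc ((fun x : ℝ => Real.exp (-x) - C * (1 - x)) 0)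
      ((fun x : ℝ => Real.exp (-x) - C * (1 - x)) 1) := by
    constructor
    · simp; linarith
    · simp; positivity
  obtain ⟨x, ⟨hx0, hx1⟩, hx⟩ := intermediate_value_Icc zero_le_one hcont hmem
  have hx' : Real.exp (-x) = C * (1 - x) := by simpa [sub_eq_zero] using hx
  have hpos : 0 < Real.exp (-x) := Real.exp_pos _
  have hlt : x < 1 := by
    rcases hx1.lt_or_eq with h | h
    · exact h
    · rw [hx', h] at hpos; simp at hpos
  refine ⟨x, ⟨hx0, hlt, hx'⟩, ?_⟩
  rintro y ⟨hy0, -, hy⟩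
  rcases lt_trichotomy x y with h | h | h
  · exact (key x y hx0 h hx' hy).elim
  · exact h.symm
  · exact (key y x hy0 h hy hx').elim

/-- For `C ≥ 1` there is exactly one solution of `e^{-ξ} = C (1 - ξ)` with `ξ ≤ 0`. -/
theorem existsUnique_xiMinus {C : ℝ} (hC : 1 ≤ C) :
    ∃! ξ : ℝ, ξ ≤ 0 ∧ Real.exp (-ξ) = C * (1 - ξ) := by
  have key : ∀ x y : ℝ, y ≤ 0 → x < y → Real.exp (-x) = C * (1 - x) →
      Real.exp (-y) = C * (1 - y) → False := by
    intro x y hy hxy ex ey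
    have h1 : y - x + 1 < Real.exp (y - x) := Real.add_one_lt_exp (by linarith)
    have h2 : Real.exp (-x) = Real.exp (y - x) * Real.exp (-y) := by
      rw [← Real.exp_add]; ring_nf
    have h3 : 0 < Real.exp (-y) := Real.exp_pos _
    have h4 : (y - x + 1) * Real.exp (-y) < Real.exp (-x) := by
      rw [h2]; exact mul_lt_mul_of_pos_right h1 h3
    rw [ex, ey] at h4
    have h5 : 0 ≤ C * (-y * (y - x)) := by
      have h6 : 0 ≤ y - x := by linarith
      have h7 : 0 ≤ -y := by linarith
      positivity
    nlinarith
  have hcont : ContinuousOn (fun x : ℝ => Real.exp (-x) - C * (1 - x)) (Icc (-(2 * C)) 0) := by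
    fun_prop
  have hmem : (0 : ℝ) ∈ Icc ((fun x : ℝ => Real.exp (-x) - C * (1 - x)) 0)
      ((fun x : ℝ => Real.exp (-x) - C * (1 - x)) (-(2 * C))) := by
    constructor
    · simp; linarith
    · have := Real.quadratic_le_exp_of_nonneg (x := 2 * C) (by linarith)
      simp only [neg_neg, sub_neg_eq_add]
      nlinarith
  obtain ⟨x, ⟨-, hx0⟩, hx⟩ := intermediate_value_Icc' (by linarith) hcont hmem
  have hx' : Real.exp (-x) = C * (1 - x) := by simpa [sub_eq_zero] using hx
  refine ⟨x, ⟨hx0, hx'⟩, ?_⟩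
  rintro y ⟨hy0, hy⟩
  rcases lt_trichotomy x y with h | h | h
  · exact (key x y hy0 h hx' hy).elim
  · exact h.symm
  · exact (key y x hx0 h hy hx').elim

/-- `ξ⁺(C)`: the solution of `e^{-ξ} = C (1 - ξ)` in `[0,1)`, for `C ≥ 1`. -/
def xiPlus (C : ℝ) : ℝ :=
  sSup {ξ : ℝ | 0 ≤ ξ ∧ ξ < 1 ∧ Real.exp (-ξ) = C * (1 - ξ)}

/-- `ξ⁻(C)`: the solution of `e^{-ξ} = C (1 - ξ)` in `(-∞,0]`, for `C ≥ 1`. -/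
def xiMinus (C : ℝ) : ℝ :=
  sInf {ξ : ℝ | ξ ≤ 0 ∧ Real.exp (-ξ) = C * (1 - ξ)}

theorem xiPlus_spec {C : ℝ} (hC : 1 ≤ C) :
    0 ≤ xiPlus C ∧ xiPlus C < 1 ∧ Real.exp (-xiPlus C) = C * (1 - xiPlus C) := by
  obtain ⟨x, hx, hu⟩ := existsUnique_xiPlus hC
  have hs : {ξ : ℝ | 0 ≤ ξ ∧ ξ < 1 ∧ Real.exp (-ξ) = C * (1 - ξ)} = {x} :=
    Set.eq_singleton_iff_unique_mem.2 ⟨hx, hu⟩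
  have h : xiPlus C = x := by rw [xiPlus, hs, csSup_singleton]
  rw [h]; exact hx

theorem xiMinus_spec {C : ℝ} (hC : 1 ≤ C) :
    xiMinus C ≤ 0 ∧ Real.exp (-xiMinus C) = C * (1 - xiMinus C) := by
  obtain ⟨x, hx, hu⟩ := existsUnique_xiMinus hC
  have hs : {ξ : ℝ | ξ ≤ 0 ∧ Real.exp (-ξ) = C * (1 - ξ)} = {x} :=
    Set.eq_singleton_iff_unique_mem.2 ⟨hx, hu⟩
  have h : xiMinus C = x := by rw [xiMinus, hs, csInf_singleton]
  rw [h]; exact hx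

/-- The function `k` on `[1,∞)`. For `C = 1` it is set to `0`. -/
def k (C : ℝ) : ℝ :=
  if C = 1 then 0 else
    2 * ((1 - xiMinus C) * (1 - xiPlus C) / (xiPlus C - xiMinus C)) * (C - 1)

/-- The inverse of `k : [1,∞) → [0,2/e)`. -/
def kInv (ε : ℝ) : ℝ :=
  Function.invFunOn k (Ici 1) ε

end BMOUnitInterval

end

/-! Lower bounds come from multiples δ·(-log t) of the logarithm. Under t = e^{-s} the function -log
t is a mean-one exponential variable, so the exponential ratio on (0,1) is e^{-δ}/(1-δ) and becomes
infinite at δ = 1, while the p-th power oscillation of -log t over (0,1) is `logNormPow p`. No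
subinterval has a larger oscillation: adding a comonotone function never decreases the oscillation
(`lintegral_osc_le_of_monovaryOn`), and rescaled logarithms differ from the full one by such a
function.

For the upper bounds the same comonotonicity lets one truncate, so φ may be taken bounded. Let C be
its own best exponential constant over all subintervals; the aim is to bound the oscillation on a
nearly optimal interval from below by a function of C. With e^{-ξ} = C(1-ξ), the exponential bound
on an interval of mean v+ξ says exactly that `gap ξ (φ - v)` has nonnegative integral. The rising
sun lemma produces unions of such intervals, and the sign pattern of the gap transfers the estimate
to the level sets {v < φ} when ξ = ξ⁺, or {φ < v} when ξ = ξ⁻.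

For p = 1, one superlevel and one sublevel set at the mean give k(C) ≤ ε
(`integral_abs_ge_of_expBound`). For 1 < p ≤ 2, put δ = ξ⁺(C). Then |s|^p is a function affine in s
and e^{δs}, plus an integral of gaps over levels w > -1 with weight `tangentDensity`; the weight is
nonnegative once δ ≥ 2-p. Integrating over an interval and using Fubini bounds ∫|φ|^p below through
∫φ and ∫e^φ alone (`exists_integral_abs_rpow_ge`). On nearly optimal intervals this yields δ^p ·
`logNormPow p` ≤ ε^p, matching the logarithm.

The function k is 2(C-1) divided by the width of the sublevel set at height C of the strictly convex
function `mulExpInv`. Convexity gives its monotonicity, and monotonicity of the width replaces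
continuity in the proof of surjectivity. -/

namespace BMOUnitInterval

open Filter Topology

/-! ### Rising sun lemma -/

/-- Rising sun lemma for a continuous function that is maximal at the left endpoint. -/
theorem rising_sun_of_max_left {F : ℝ → ℝ} {a b : ℝ} (hF : ContinuousOn F (Icc a b))
    (ha : ∀ x ∈ Icc a b, F x ≤ F a) :
    ∃ S : Set (ℝ × ℝ), S.Countable ∧
      (∀ I ∈ S, a ≤ I.1 ∧ I.1 < I.2 ∧ I.2 ≤ b ∧ F I.1 = F I.2) ∧
      S.PairwiseDisjoint (fun I => Ioo I.1 I.2) ∧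
      ∀ x ∈ Icc a b, x ∉ ⋃ I ∈ S, Ioo I.1 I.2 → ∀ y ∈ Icc x b, F y ≤ F x := by
  set U : Set ℝ := {x | x ∈ Icc a b ∧ ∃ y ∈ Icc x b, F x < F y} with hU
  -- The components of `U`, encoded as intervals inside `U` with both endpoints outside it;
  -- disjointness is then pure order reasoning.
  set S : Set (ℝ × ℝ) := {I | a ≤ I.1 ∧ I.1 < I.2 ∧ I.2 ≤ b ∧ I.1 ∉ U ∧ I.2 ∉ U ∧
    Ioo I.1 I.2 ⊆ U} with hS
  have hdisj : S.PairwiseDisjoint (fun I => Ioo I.1 I.2) := by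
    rintro ⟨c, d⟩ ⟨-, -, -, hc, hd, hcd⟩ ⟨c', d'⟩ ⟨-, -, -, hc', hd', hcd'⟩ hne
    by_contra hnd
    obtain ⟨y, hy, hy'⟩ := Set.not_disjoint_iff.1 hnd
    apply hne
    simp only at *
    have h1 : c = c' := by
      rcases lt_trichotomy c c' with h | h | h
      · exact (hc' (hcd ⟨h, hy'.1.trans hy.2⟩)).elim
      · exact h
      · exact (hc (hcd' ⟨h, hy.1.trans hy'.2⟩)).elim
    have h2 : d = d' := by
      rcases lt_trichotomy d d' with h | h | h
      · exact (hd (hcd' ⟨hy'.1.trans hy.2, h⟩)).elim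
      · exact h
      · exact (hd' (hcd ⟨hy.1.trans hy'.2, h⟩)).elim
    rw [h1, h2]
  have hnotU : ∀ x ∈ Icc a b, x ∉ U → ∀ y ∈ Icc x b, F y ≤ F x := by
    intro x hx hxU y hy
    by_contra h
    exact hxU ⟨hx, y, hy, not_le.1 h⟩
  -- A maximiser over `[x, b]` lies outside `U`.
  have hmax : ∀ x ∈ Icc a b, ∃ y ∈ Icc x b, y ∉ U ∧ F x ≤ F y := by
    intro x hx
    obtain ⟨y, hy, hym⟩ := isCompact_Icc.exists_isMaxOn (nonempty_Icc.2 hx.2)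
      (hF.mono (Icc_subset_Icc_left hx.1))
    refine ⟨y, hy, ?_, hym (left_mem_Icc.2 hx.2)⟩
    rintro ⟨-, z, hz, hyz⟩
    exact absurd (hym (show z ∈ Icc x b from ⟨hy.1.trans hz.1, hz.2⟩)) (not_le.2 hyz)
  refine ⟨S, ?_, ?_, hdisj, ?_⟩
  · refine hdisj.countable_of_isOpen (fun _ _ => isOpen_Ioo) ?_
    rintro I ⟨-, h, -⟩
    exact nonempty_Ioo.2 h
  · rintro ⟨c, d⟩ ⟨hac, hcd, hdb, hc, hd, hsub⟩
    simp only at *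
    refine ⟨hac, hcd, hdb, le_antisymm ?_ (hnotU c ⟨hac, hcd.le.trans hdb⟩ hc d ⟨hcd.le, hdb⟩)⟩
    -- For x just right of c, a maximiser over [x,b] lies outside `U`, hence at or beyond d, so F x
    -- ≤ F d. Let x decrease to c.
    have hlim : Tendsto F (𝓝[>] c) (𝓝 (F c)) := by
      have h1 := (hF c ⟨hac, hcd.le.trans hdb⟩).mono (Ioc_subset_Icc_self.trans
        (Icc_subset_Icc_left hac))
      rwa [ContinuousWithinAt, nhdsWithin_Ioc_eq_nhdsGT (hcd.trans_le hdb)] at h1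
    refine le_of_tendsto hlim ?_
    filter_upwards [Ioo_mem_nhdsGT hcd] with x hx
    obtain ⟨y, hy, hyU, hxy⟩ := hmax x ⟨hac.trans hx.1.le, hx.2.le.trans hdb⟩
    have hdy : d ≤ y := by
      by_contra h
      exact hyU (hsub ⟨hx.1.trans_le hy.1, not_le.1 h⟩)
    exact hxy.trans (hnotU d ⟨hac.trans hcd.le, hdb⟩ hd y ⟨hdy, hy.2⟩)
  · intro x hx hxS
    apply hnotU x hx
    intro hxU
    apply hxS
    have haU : a ∉ U := by
      rintro ⟨-, y, hy, hlt⟩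
      exact absurd (ha y hy) (not_le.2 hlt)
    have hbU : b ∉ U := by
      rintro ⟨-, y, hy, hlt⟩
      rw [le_antisymm hy.2 hy.1] at hlt
      exact lt_irrefl _ hlt
    -- `U` is relatively open
    have hopen : ∀ z ∈ U, ∀ᶠ w in 𝓝[Icc a b] z, w ∈ U := by
      rintro z ⟨hz, y, hy, hlt⟩
      have hzy : z < y := lt_of_le_of_ne hy.1 (by rintro rfl; exact lt_irrefl _ hlt)
      filter_upwards [(hF z hz).eventually_lt continuousWithinAt_const hlt,
        nhdsWithin_le_nhds (Iio_mem_nhds hzy), self_mem_nhdsWithin] with w hw hwy hwI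
      exact ⟨hwI, y, ⟨le_of_lt hwy, hy.2⟩, hw⟩
    have hclosed : IsClosed (Icc a b \ U) := by
      rw [← isOpen_compl_iff, isOpen_iff_mem_nhds]
      intro z hz
      by_cases hzI : z ∈ Icc a b
      · have hzU : z ∈ U := by
          by_contra h; exact hz ⟨hzI, h⟩
        have := eventually_nhdsWithin_iff.1 (hopen z hzU)
        filter_upwards [this] with w hw
        exact fun hw' => hw'.2 (hw hw'.1)
      · filter_upwards [isClosed_Icc.isOpen_compl.mem_nhds hzI] with w hw
        exact fun hw' => hw hw'.1
    have hK1 : IsCompact ((Icc a b \ U) ∩ Icc a x) := isCompact_Icc.inter_left hclosed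
    have hK2 : IsCompact ((Icc a b \ U) ∩ Icc x b) := isCompact_Icc.inter_left hclosed
    obtain ⟨c, ⟨⟨hcI, hcU⟩, hcx⟩, hcm⟩ := hK1.exists_isGreatest
      ⟨a, ⟨⟨left_mem_Icc.2 (hx.1.trans hx.2), haU⟩, left_mem_Icc.2 hx.1⟩⟩
    obtain ⟨d, ⟨⟨hdI, hdU⟩, hdx⟩, hdm⟩ := hK2.exists_isLeast
      ⟨b, ⟨⟨right_mem_Icc.2 (hx.1.trans hx.2), hbU⟩, right_mem_Icc.2 hx.2⟩⟩
    have hcx' : c < x := lt_of_le_of_ne hcx.2 (by rintro rfl; exact hcU hxU)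
    have hdx' : x < d := lt_of_le_of_ne hdx.1 (by rintro rfl; exact hdU hxU)
    refine mem_biUnion (x := (c, d)) ⟨hcI.1, hcx'.trans hdx', hdI.2, hcU, hdU, ?_⟩ ⟨hcx', hdx'⟩
    intro y hy
    simp only at hy
    by_contra hyU
    have hyI : y ∈ Icc a b := ⟨hcI.1.trans hy.1.le, hy.2.le.trans hdI.2⟩
    rcases le_total y x with h | h
    · exact absurd (hcm ⟨⟨hyI, hyU⟩, hyI.1, h⟩) (not_le.2 hy.1)
    · exact absurd (hdm ⟨⟨hyI, hyU⟩, h, hyI.2⟩) (not_le.2 hy.2)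

/-- Rising sun lemma: if `F b ≤ F a`, then off a countable disjoint union of intervals with equal
values at the endpoints, `F` dominates all its later values. -/
theorem rising_sun {F : ℝ → ℝ} {a b : ℝ} (hab : a ≤ b) (hF : ContinuousOn F (Icc a b))
    (hba : F b ≤ F a) :
    ∃ S : Set (ℝ × ℝ), S.Countable ∧
      (∀ I ∈ S, a ≤ I.1 ∧ I.1 < I.2 ∧ I.2 ≤ b ∧ F I.1 = F I.2) ∧
      S.PairwiseDisjoint (fun I => Ioo I.1 I.2) ∧
      ∀ x ∈ Ioo a b, x ∉ ⋃ I ∈ S, Ioo I.1 I.2 → ∀ y ∈ Icc x b, F y ≤ F x := by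
  have hcl : IsCompact (Icc a b ∩ F ⁻¹' {F a}) :=
    isCompact_Icc.of_isClosed_subset
      (hF.preimage_isClosed_of_isClosed isClosed_Icc isClosed_singleton) inter_subset_left
  -- d is the last point where F takes the value F a. Since F b ≤ F a, F cannot exceed F d
  -- afterwards, so the first version applies on [d,b], and (a,d) joins the family as one more
  -- interval.
  obtain ⟨d, ⟨hd, hFd⟩, hdm⟩ := hcl.exists_isGreatest ⟨a, left_mem_Icc.2 hab, rfl⟩
  have hFd : F d = F a := hFd
  have hlater : ∀ x ∈ Icc d b, F x ≤ F d := by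
    intro x hx
    by_contra! h
    have hsub : Icc x b ⊆ Icc a b := Icc_subset_Icc_left (hd.1.trans hx.1)
    obtain ⟨y, hy, hyF⟩ := intermediate_value_Icc' hx.2 (hF.mono hsub)
      (show F a ∈ Icc (F b) (F x) from ⟨hba, hFd ▸ h.le⟩)
    have hyd : y ≤ d := hdm ⟨hsub hy, hyF⟩
    have : x = d := le_antisymm (hy.1.trans hyd) hx.1
    exact lt_irrefl _ (this ▸ h)
  obtain ⟨S, hSc, hS, hSd, hSx⟩ := rising_sun_of_max_left (hF.mono (Icc_subset_Icc_left hd.1)) hlater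
  by_cases had : a = d
  · subst had
    exact ⟨S, hSc, hS, hSd, fun x hx => hSx x (Ioo_subset_Icc_self hx)⟩
  have had : a < d := lt_of_le_of_ne hd.1 had
  refine ⟨insert (a, d) S, hSc.insert _, ?_, ?_, ?_⟩
  · rintro I (rfl | hI)
    · exact ⟨le_rfl, had, hd.2, hFd.symm⟩
    · obtain ⟨h1, h2, h3, h4⟩ := hS I hI
      exact ⟨hd.1.trans h1, h2, h3, h4⟩
  · refine hSd.insert fun I hI _ => ?_
    refine Set.disjoint_left.2 fun y hy hy' => ?_
    exact absurd (hy.2.trans_le (hS I hI).1) (not_lt.2 hy'.1.le)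
  · intro x hx hxS
    simp only [mem_insert_iff, iUnion_iUnion_eq_or_left, mem_union, not_or] at hxS
    refine hSx x ⟨?_, hx.2.le⟩ hxS.2
    by_contra! h
    exact hxS.1 ⟨hx.1, h⟩

/-- Selection of a set `E ⊆ (a,b)` composed of intervals on which `φ` has mean exactly `α`, such
that `φ ≤ α` almost everywhere off `E`. Any integral estimate valid on intervals with mean `α`
passes to `E`. -/
theorem exists_set_of_rising_sun {φ h : ℝ → ℝ} {a b α : ℝ} (hab : a ≤ b)
    (hφ : IntegrableOn φ (Ioo a b)) (hmean : ∫ x in Ioo a b, φ x ≤ α * (b - a))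
    (hh : IntegrableOn h (Ioo a b))
    (hI : ∀ c d, a ≤ c → c < d → d ≤ b → ∫ x in Ioo c d, φ x = α * (d - c) →
      0 ≤ ∫ x in Ioo c d, h x) :
    ∃ E, MeasurableSet E ∧ E ⊆ Ioo a b ∧ 0 ≤ ∫ x in E, h x ∧
      ∀ᵐ x, x ∈ Ioo a b → x ∉ E → φ x ≤ α := by
  have hφi : IntervalIntegrable φ volume a b := by
    rwa [intervalIntegrable_iff_integrableOn_Ioo_of_le hab]
  have hsubi : ∀ c d, a ≤ c → c ≤ d → d ≤ b → IntervalIntegrable φ volume c d := by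
    intro c d hac hcd hdb
    rw [intervalIntegrable_iff_integrableOn_Ioo_of_le hcd]
    exact hφ.mono_set (Ioo_subset_Ioo hac hdb)
  -- Equal values of F at c and d mean that φ has mean α on (c,d).
  set F : ℝ → ℝ := fun x => (∫ t in a..x, φ t) - α * (x - a) with hFdef
  have hFdiff : ∀ c d, a ≤ c → c ≤ d → d ≤ b →
      F d - F c = (∫ x in Ioo c d, φ x) - α * (d - c) := by
    intro c d hac hcd hdb
    rw [← integral_Ioc_eq_integral_Ioo, ← intervalIntegral.integral_of_le hcd,
      ← intervalIntegral.integral_interval_sub_left (hsubi a d le_rfl (hac.trans hcd) hdb)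
        (hsubi a c le_rfl hac (hcd.trans hdb))]
    simp only [hFdef]; ring
  have hF : ContinuousOn F (Icc a b) := by
    refine ContinuousOn.sub ?_ (by fun_prop)
    have := intervalIntegral.continuousOn_primitive_interval (μ := volume) (f := φ) (a := a) (b := b)
      (by rw [uIcc_of_le hab]; exact (integrableOn_Icc_iff_integrableOn_Ioo).2 hφ)
    rwa [uIcc_of_le hab] at this
  have hba : F b ≤ F a := by
    have := hFdiff a b le_rfl hab le_rfl
    linarith
  obtain ⟨S, hSc, hS, hSd, hSx⟩ := rising_sun hab hF hba
  have hEsub : (⋃ I ∈ S, Ioo I.1 I.2) ⊆ Ioo a b :=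
    iUnion₂_subset fun I hI => Ioo_subset_Ioo (hS I hI).1 (hS I hI).2.2.1
  refine ⟨⋃ I ∈ S, Ioo I.1 I.2, MeasurableSet.biUnion hSc fun _ _ => measurableSet_Ioo, hEsub, ?_, ?_⟩
  · have : Countable S := hSc
    rw [biUnion_eq_iUnion, integral_iUnion (ι := S) (fun _ => measurableSet_Ioo)
      (fun i j hij => hSd i.2 j.2 (fun h => hij (Subtype.ext h)))
      (hh.mono_set (by rwa [← biUnion_eq_iUnion S fun I _ => Ioo I.1 I.2]))]
    refine tsum_nonneg fun I => ?_
    obtain ⟨h1, h2, h3, h4⟩ := hS I.1 I.2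
    refine hI _ _ h1 h2 h3 ?_
    have := hFdiff _ _ h1 h2.le h3
    linarith
  -- Lebesgue differentiation: almost everywhere F' = φ - α, and off the intervals all forward
  -- slopes of F are nonpositive.
  · filter_upwards [hφi.ae_hasDerivAt_integral] with x hx hxI hxE
    rw [uIcc_of_le hab] at hx
    have hd : HasDerivAt F (φ x - α) x := by
      have h1 := hx (Ioo_subset_Icc_self hxI) a (left_mem_Icc.2 hab)
      have h2 : HasDerivAt (fun x : ℝ => α * (x - a)) α x := by
        simpa using ((hasDerivAt_id x).sub_const a).const_mul α
      exact h1.sub h2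
    have hslope := (hasDerivWithinAt_iff_tendsto_slope' (by simp)).1 (hd.hasDerivWithinAt (s := Ioi x))
    have : φ x - α ≤ 0 := by
      refine le_of_tendsto hslope ?_
      filter_upwards [Ioo_mem_nhdsGT hxI.2] with y hy
      rw [slope_def_field]
      have := hSx x hxI hxE y ⟨hy.1.le, hy.2.le⟩
      exact div_nonpos_of_nonpos_of_nonneg (by linarith) (by linarith [hy.1])
    linarith

/-! ### Integral estimates over level sets -/

/-- The one-sided gap `r - (1 - ξ)(e^r - 1)` between the tangent line and the exponential. -/
noncomputable def gap (ξ r : ℝ) : ℝ := r - (1 - ξ) * (Real.exp r - 1)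

theorem continuous_gap (ξ : ℝ) : Continuous (gap ξ) := by
  unfold gap; fun_prop

theorem gap_nonpos_of_nonpos {ξ r : ℝ} (h0 : 0 ≤ ξ) (h1 : ξ ≤ 1) (hr : r ≤ 0) : gap ξ r ≤ 0 := by
  have := Real.add_one_le_exp r
  unfold gap
  nlinarith [mul_nonneg (sub_nonneg.2 h1) (by linarith : 0 ≤ Real.exp r - 1 - r),
    mul_nonneg h0 (neg_nonneg.2 hr)]

theorem gap_nonpos_of_nonneg {ξ r : ℝ} (h0 : ξ ≤ 0) (hr : 0 ≤ r) : gap ξ r ≤ 0 := by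
  have := Real.add_one_le_exp r
  unfold gap
  nlinarith [mul_nonneg (by linarith : 0 ≤ 1 - ξ) (by linarith : 0 ≤ Real.exp r - 1 - r),
    mul_nonneg (neg_nonneg.2 h0) hr]

/-- Since e^r ≥ 1, replacing ξ by r ≤ ξ only lowers the gap, to 1 - (1-r)e^r ≥ 0. -/
theorem gap_nonneg_of_mem_Icc {ξ r : ℝ} (h1 : ξ < 1) (hr0 : 0 ≤ r) (hr : r ≤ ξ) : 0 ≤ gap ξ r := by
  have h2 : (1 - r) * Real.exp r ≤ 1 := by
    have := Real.add_one_le_exp (-r)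
    have h3 : Real.exp (-r) * Real.exp r = 1 := by rw [← Real.exp_add]; simp
    nlinarith [Real.exp_pos r]
  have h4 : 1 ≤ Real.exp r := Real.one_le_exp hr0
  unfold gap
  nlinarith

theorem gap_nonneg_of_mem_Icc' {ξ r : ℝ} (hr0 : r ≤ 0) (hr : ξ ≤ r) : 0 ≤ gap ξ r := by
  have h2 : (1 - r) * Real.exp r ≤ 1 := by
    have := Real.add_one_le_exp (-r)
    have h3 : Real.exp (-r) * Real.exp r = 1 := by rw [← Real.exp_add]; simp
    nlinarith [Real.exp_pos r]
  have h4 : Real.exp r ≤ 1 := Real.exp_le_one_iff.2 hr0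
  unfold gap
  nlinarith

/-- The exponential integral condition `⟨e^φ⟩_I ≤ C e^{⟨φ⟩_I}` on all subintervals of `(a,b)`, in
terms of integrals. -/
def ExpBound (C : ℝ) (φ : ℝ → ℝ) (a b : ℝ) : Prop :=
  ∀ c d, a ≤ c → c < d → d ≤ b →
    ∫ x in Ioo c d, Real.exp (φ x) ≤ C * (d - c) * Real.exp ((∫ x in Ioo c d, φ x) / (d - c))

theorem integrableOn_Ioo_of_bounded {φ : ℝ → ℝ} (hφ : Measurable φ) {N : ℝ} (hN : ∀ x, |φ x| ≤ N)
    (a b : ℝ) : IntegrableOn φ (Ioo a b) :=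
  Measure.integrableOn_of_bounded (M := N) (by simp) hφ.aestronglyMeasurable
    (ae_of_all _ (by simpa using hN))

theorem integrableOn_comp_of_bounded {φ g : ℝ → ℝ} (hφ : Measurable φ) {N : ℝ}
    (hN : ∀ x, |φ x| ≤ N) (hg : Continuous g) (a b : ℝ) :
    IntegrableOn (fun x => g (φ x)) (Ioo a b) := by
  obtain ⟨B, hB⟩ := (isCompact_Icc (a := -N) (b := N)).exists_bound_of_continuousOn hg.continuousOn
  exact integrableOn_Ioo_of_bounded (hg.measurable.comp hφ)
    (fun x => hB (φ x) (abs_le.1 (hN x))) a b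

/-- With mean v+ξ the exponential bound reads (1-ξ)∫e^{φ-v} ≤ C(1-ξ)e^ξ(d-c), and the equation for ξ
makes the right side d-c. -/
theorem integral_gap_nonneg {φ : ℝ → ℝ} (hφ : Measurable φ) {N : ℝ} (hN : ∀ x, |φ x| ≤ N)
    {a b C ξ : ℝ} (hC : ExpBound C φ a b) (hξ : Real.exp (-ξ) = C * (1 - ξ)) (hξ1 : ξ < 1) (v : ℝ)
    {c d : ℝ} (hac : a ≤ c) (hcd : c < d) (hdb : d ≤ b)
    (hm : ∫ x in Ioo c d, φ x = (v + ξ) * (d - c)) :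
    0 ≤ ∫ x in Ioo c d, gap ξ (φ x - v) := by
  have h := hC c d hac hcd hdb
  have hdc : 0 < d - c := sub_pos.2 hcd
  rw [hm, mul_div_assoc, div_self hdc.ne', mul_one] at h
  have hie := integrableOn_comp_of_bounded hφ hN Real.continuous_exp c d
  have hi := integrableOn_Ioo_of_bounded hφ hN c d
  have h1 : ∀ x, gap ξ (φ x - v) = φ x - (1 - ξ) * Real.exp (-v) * Real.exp (φ x) + (1 - ξ - v) := by
    intro x
    rw [gap, sub_eq_add_neg (φ x) v, Real.exp_add]; ring
  simp_rw [h1]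
  rw [integral_add (f := fun x => φ x - (1 - ξ) * Real.exp (-v) * Real.exp (φ x))
    (hi.sub (hie.const_mul _)) (by simp), integral_sub hi (hie.const_mul _),
    integral_const_mul, hm]
  simp only [integral_const, measureReal_restrict_apply_univ, Real.volume_real_Ioo_of_le hcd.le,
    smul_eq_mul]
  have h2 : (1 - ξ) * Real.exp (-v) * ∫ x in Ioo c d, Real.exp (φ x) ≤ d - c := by
    calc (1 - ξ) * Real.exp (-v) * ∫ x in Ioo c d, Real.exp (φ x)
        ≤ (1 - ξ) * Real.exp (-v) * (C * (d - c) * Real.exp (v + ξ)) := by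
          gcongr
      _ = (C * (1 - ξ)) * (d - c) * (Real.exp (-v) * Real.exp (v + ξ)) := by ring
      _ = (d - c) * (Real.exp (-ξ) * Real.exp ξ) := by
          rw [← hξ, ← Real.exp_add]; ring_nf
      _ = d - c := by rw [← Real.exp_add]; simp
  nlinarith

/-- Comparison of the integrals of a function over two sets. -/
theorem setIntegral_le_of_sign {h : ℝ → ℝ} {s E F : Set ℝ} (hE : MeasurableSet E)
    (hF : MeasurableSet F) (hEs : E ⊆ s) (hFs : F ⊆ s) (hh : IntegrableOn h s)
    (h1 : ∀ᵐ x, x ∈ E → x ∉ F → h x ≤ 0) (h2 : ∀ᵐ x, x ∈ F → x ∉ E → 0 ≤ h x) :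
    ∫ x in E, h x ≤ ∫ x in F, h x := by
  rw [← integral_indicator hE, ← integral_indicator hF]
  refine integral_mono_ae ((integrable_indicator_iff hE).2 (hh.mono_set hEs))
    ((integrable_indicator_iff hF).2 (hh.mono_set hFs)) ?_
  filter_upwards [h1, h2] with x h1 h2
  by_cases hxE : x ∈ E <;> by_cases hxF : x ∈ F <;> simp_all

/-- Start from the rising sun set at level α = v+ξ, whose gap integral is nonnegative. Passing to {v
< φ} discards points with φ ≤ v, where the gap is nonpositive, and adds points with v < φ ≤ v+ξ,
where it is nonnegative. -/
theorem integral_gap_superlevel_nonneg {φ : ℝ → ℝ} (hφ : Measurable φ) {N : ℝ}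
    (hN : ∀ x, |φ x| ≤ N) {a b C ξ : ℝ} (hab : a ≤ b) (hC : ExpBound C φ a b)
    (hξ : Real.exp (-ξ) = C * (1 - ξ)) (hξ0 : 0 ≤ ξ) (hξ1 : ξ < 1) {v : ℝ}
    (hv : ∫ x in Ioo a b, φ x ≤ (v + ξ) * (b - a)) :
    0 ≤ ∫ x in Ioo a b ∩ {x | v < φ x}, gap ξ (φ x - v) := by
  have hg : Continuous fun s => gap ξ (s - v) := (continuous_gap ξ).comp (by fun_prop)
  obtain ⟨E, hEm, hEs, hE, hEφ⟩ := exists_set_of_rising_sun hab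
    (integrableOn_Ioo_of_bounded hφ hN a b) hv (integrableOn_comp_of_bounded hφ hN hg a b)
    (fun c d hac hcd hdb hm => integral_gap_nonneg hφ hN hC hξ hξ1 v hac hcd hdb hm)
  refine hE.trans (setIntegral_le_of_sign hEm (measurableSet_Ioo.inter
    (measurableSet_lt measurable_const hφ)) hEs inter_subset_left
    (integrableOn_comp_of_bounded hφ hN hg a b) ?_ ?_)
  · refine ae_of_all _ fun x hx hxv => gap_nonpos_of_nonpos hξ0 hξ1.le ?_
    by_contra! h
    exact hxv ⟨hEs hx, by simp only [mem_ofPred_eq]; linarith⟩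
  · filter_upwards [hEφ] with x hx hxv hxE
    have h1 : v < φ x := hxv.2
    exact gap_nonneg_of_mem_Icc hξ1 (by linarith) (by linarith [hx hxv.1 hxE])

/-- Mirror image through -φ: for ξ ≤ 0 the gap is nonnegative on [ξ,0] and nonpositive on [0,∞). -/
theorem integral_gap_sublevel_nonneg {φ : ℝ → ℝ} (hφ : Measurable φ) {N : ℝ}
    (hN : ∀ x, |φ x| ≤ N) {a b C ξ : ℝ} (hab : a ≤ b) (hC : ExpBound C φ a b)
    (hξ : Real.exp (-ξ) = C * (1 - ξ)) (hξ0 : ξ ≤ 0) {v : ℝ}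
    (hv : (v + ξ) * (b - a) ≤ ∫ x in Ioo a b, φ x) :
    0 ≤ ∫ x in Ioo a b ∩ {x | φ x < v}, gap ξ (φ x - v) := by
  have hg : Continuous fun s => gap ξ (s - v) := (continuous_gap ξ).comp (by fun_prop)
  obtain ⟨E, hEm, hEs, hE, hEφ⟩ := exists_set_of_rising_sun (φ := fun x => -φ x) (α := -(v + ξ)) hab
    (integrableOn_Ioo_of_bounded hφ hN a b).neg (by rw [integral_neg]; linarith)
    (integrableOn_comp_of_bounded hφ hN hg a b)
    (fun c d hac hcd hdb hm => integral_gap_nonneg hφ hN hC hξ (by linarith) v hac hcd hdb (by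
      rw [integral_neg] at hm; linarith))
  refine hE.trans (setIntegral_le_of_sign hEm (measurableSet_Ioo.inter
    (measurableSet_lt hφ measurable_const)) hEs inter_subset_left
    (integrableOn_comp_of_bounded hφ hN hg a b) ?_ ?_)
  · refine ae_of_all _ fun x hx hxv => gap_nonpos_of_nonneg hξ0 ?_
    by_contra! h
    exact hxv ⟨hEs hx, by simp only [mem_ofPred_eq]; linarith⟩
  · filter_upwards [hEφ] with x hx hxv hxE
    have h1 : φ x < v := hxv.2
    exact gap_nonneg_of_mem_Icc' (by linarith) (by linarith [hx hxv.1 hxE])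

/-- Lower bound for the `L¹`-oscillation in terms of the exponential integral. -/
theorem integral_abs_ge_of_expBound {φ : ℝ → ℝ} (hφ : Measurable φ) {N : ℝ}
    (hN : ∀ x, |φ x| ≤ N) {a b C ξ η : ℝ} (hab : a ≤ b) (hC : ExpBound C φ a b)
    (hξ : Real.exp (-ξ) = C * (1 - ξ)) (hξ0 : 0 ≤ ξ) (hξ1 : ξ < 1)
    (hη : Real.exp (-η) = C * (1 - η)) (hη0 : η ≤ 0) (hm : ∫ x in Ioo a b, φ x = 0) :
    2 * ((∫ x in Ioo a b, Real.exp (φ x)) - (b - a)) ≤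
      (1 / (1 - ξ) - 1 / (1 - η)) * ∫ x in Ioo a b, |φ x| := by
  have hba : 0 ≤ b - a := sub_nonneg.2 hab
  have h1 := integral_gap_superlevel_nonneg hφ hN hab hC hξ hξ0 hξ1 (v := 0)
    (by rw [hm]; nlinarith)
  have h2 := integral_gap_sublevel_nonneg hφ hN hab hC hη hη0 (v := 0)
    (by rw [hm]; nlinarith)
  have hmp : MeasurableSet {x | 0 < φ x} := measurableSet_lt measurable_const hφ
  have hmn : MeasurableSet {x | φ x < 0} := measurableSet_lt hφ measurable_const
  have hi := integrableOn_Ioo_of_bounded hφ hN a b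
  have hie := integrableOn_comp_of_bounded hφ hN Real.continuous_exp a b
  -- The coefficients are chosen so that the terms in |φ| and φ add up to 2φ/(1-ξ) where φ > 0 and
  -- to 2φ/(1-η) where φ < 0. The linear term then integrates to zero.
  have hpoint : ∀ x, 2 * (Real.exp (φ x) - 1) =
      (1 / (1 - ξ) - 1 / (1 - η)) * |φ x| + (1 / (1 - ξ) + 1 / (1 - η)) * φ x
      - 2 / (1 - ξ) * {x | 0 < φ x}.indicator (fun x => gap ξ (φ x - 0)) x
      - 2 / (1 - η) * {x | φ x < 0}.indicator (fun x => gap η (φ x - 0)) x := by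
    intro x
    have e1 : 1 - ξ ≠ 0 := by linarith
    have e2 : 1 - η ≠ 0 := by linarith
    rcases lt_trichotomy (φ x) 0 with h | h | h
    · rw [indicator_of_notMem (by simp [h.le]), indicator_of_mem (by simpa using h), abs_of_neg h, gap]
      field_simp
      ring_nf
    · simp [h]
    · rw [indicator_of_mem (by simpa using h), indicator_of_notMem (by simp [h.le]), abs_of_pos h, gap]
      field_simp
      ring_nf
  have hg1 : IntegrableOn ({x | 0 < φ x}.indicator (fun x => gap ξ (φ x - 0))) (Ioo a b) :=
    (integrableOn_comp_of_bounded hφ hN (g := fun s => gap ξ (s - 0))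
      ((continuous_gap ξ).comp (by fun_prop)) a b).indicator hmp
  have hg2 : IntegrableOn ({x | φ x < 0}.indicator (fun x => gap η (φ x - 0))) (Ioo a b) :=
    (integrableOn_comp_of_bounded hφ hN (g := fun s => gap η (s - 0))
      ((continuous_gap η).comp (by fun_prop)) a b).indicator hmn
  have hlhs : ∫ x in Ioo a b, 2 * (Real.exp (φ x) - 1) =
      2 * ((∫ x in Ioo a b, Real.exp (φ x)) - (b - a)) := by
    rw [integral_const_mul, integral_sub hie (by simp)]
    simp [Real.volume_real_Ioo_of_le hab]
  have hi1 := hi.abs.const_mul (1 / (1 - ξ) - 1 / (1 - η))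
  have hi2 := hi.const_mul (1 / (1 - ξ) + 1 / (1 - η))
  have hi3 := hg1.const_mul (2 / (1 - ξ))
  have hi4 := hg2.const_mul (2 / (1 - η))
  have hi12 := hi1.add hi2
  have hi123 := hi12.sub hi3
  rw [← hlhs]
  simp_rw [hpoint]
  erw [integral_sub hi123 hi4, integral_sub hi12 hi3, integral_add hi1 hi2]
  simp only [integral_const_mul, hm, setIntegral_indicator hmp, setIntegral_indicator hmn]
  have e1 : 0 ≤ 2 / (1 - ξ) := div_nonneg (by norm_num) (by linarith)
  have e2 : 0 ≤ 2 / (1 - η) := div_nonneg (by norm_num) (by linarith)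
  nlinarith [mul_nonneg e1 h1, mul_nonneg e2 h2]

/-! ### Comonotone perturbations increase the oscillation -/

/-- A subgradient of `|·|^p`. -/
noncomputable def absPowSubgrad (p x : ℝ) : ℝ := p * (|x| ^ p / x)

theorem abs_rpow_add_subgrad_le {p : ℝ} (hp : 1 ≤ p) (x y : ℝ) :
    |x| ^ p + absPowSubgrad p x * (y - x) ≤ |y| ^ p := by
  -- At x = 0 division by zero gives slope 0, which is a valid subgradient. Elsewhere the claim is
  -- Bernoulli's inequality at y/x, scaled by |x|^p.
  rcases eq_or_ne x 0 with rfl | hx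
  · simp only [absPowSubgrad, div_zero, mul_zero, zero_mul, add_zero, abs_zero,
      Real.zero_rpow (by linarith : p ≠ 0)]
    positivity
  have hb : ∀ z : ℝ, 1 + p * z ≤ |1 + z| ^ p := by
    intro z
    rcases le_total (-1) z with h | h
    · rw [abs_of_nonneg (by linarith)]
      exact one_add_mul_self_le_rpow_one_add h hp
    · have : 1 + p * z ≤ 0 := by nlinarith
      exact this.trans (by positivity)
  have h1 := hb ((y - x) / x)
  have h2 : 1 + (y - x) / x = y / x := by field_simp; ring
  rw [h2, abs_div, Real.div_rpow (abs_nonneg _) (abs_nonneg _), le_div_iff₀ (by positivity)] at h1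
  refine le_trans (le_of_eq ?_) h1
  rw [absPowSubgrad]; ring

theorem monotone_absPowSubgrad {p : ℝ} (hp : 1 ≤ p) : Monotone (absPowSubgrad p) := by
  intro x y hxy
  rcases hxy.eq_or_lt with rfl | hlt
  · rfl
  have h1 := abs_rpow_add_subgrad_le hp x y
  have h2 := abs_rpow_add_subgrad_le hp y x
  nlinarith

/-- Chebyshev's integral inequality for a bounded function. -/
theorem integral_mul_sub_average_nonneg {α : Type*} [MeasurableSpace α] {μ : Measure α}
    [IsProbabilityMeasure μ] {Z Y : α → ℝ} {s : Set α} {B : ℝ} (hs : ∀ᵐ x ∂μ, x ∈ s)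
    (hZm : AEStronglyMeasurable Z μ) (hZ : ∀ x ∈ s, |Z x| ≤ B) (hY : Integrable Y μ)
    (h : MonovaryOn Z Y s) : 0 ≤ ∫ x, Z x * (Y x - ∫ y, Y y ∂μ) ∂μ := by
  set m := ∫ y, Y y ∂μ with hm
  -- Monovariation separates the values of Z on {Y < m} from those on {Y > m}; k is the supremum
  -- over the former. Subtracting k does not change the integral, because Y - m has mean zero.
  obtain ⟨k, hk⟩ : ∃ k, ∀ x ∈ s, 0 ≤ (Z x - k) * (Y x - m) := by
    set A : Set ℝ := Z '' {x | x ∈ s ∧ Y x < m} with hA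
    have hAbdd : BddAbove A := ⟨B, by rintro _ ⟨x, hx, rfl⟩; exact (abs_le.1 (hZ x hx.1)).2⟩
    rcases A.eq_empty_or_nonempty with hAe | hAn
    · refine ⟨-B, fun x hx => mul_nonneg (by linarith [(abs_le.1 (hZ x hx)).1]) ?_⟩
      by_contra! hlt
      have : Z x ∈ A := ⟨x, ⟨hx, by linarith⟩, rfl⟩
      rw [hAe] at this
      exact this
    · refine ⟨sSup A, fun x hx => ?_⟩
      rcases lt_trichotomy (Y x) m with hlt | heq | hgt
      · have : Z x ≤ sSup A := le_csSup hAbdd ⟨x, ⟨hx, hlt⟩, rfl⟩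
        exact mul_nonneg_of_nonpos_of_nonpos (by linarith) (by linarith)
      · simp [heq]
      · have : sSup A ≤ Z x := csSup_le hAn (by
          rintro _ ⟨y, hy, rfl⟩
          exact h hy.1 hx (hy.2.trans hgt))
        exact mul_nonneg (by linarith) (by linarith)
  have hYm : Integrable (fun x => Y x - m) μ := hY.sub (integrable_const _)
  have hint : Integrable (fun x => Z x * (Y x - m)) μ :=
    hYm.bdd_mul (c := B) hZm (by filter_upwards [hs] with x hx using hZ x hx)
  have h0 : ∫ x, (Y x - m) ∂μ = 0 := by
    rw [integral_sub hY (integrable_const _)]; simp [hm]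
  have h1 : 0 ≤ ∫ x, (Z x - k) * (Y x - m) ∂μ :=
    integral_nonneg_of_ae (by filter_upwards [hs] with x hx using hk x hx)
  have h2 : ∫ x, (Z x - k) * (Y x - m) ∂μ = ∫ x, Z x * (Y x - m) ∂μ := by
    simp_rw [sub_mul]
    rw [integral_sub hint (hYm.const_mul k), integral_const_mul, h0]; simp
  rwa [h2] at h1

/-- By convexity |W-n|^p exceeds |X-m|^p by at least a subgradient at X-m times the centred
difference W-X. The subgradient is nondecreasing in X, so this product has nonnegative integral by
Chebyshev. -/
theorem lintegral_osc_le_of_monovaryOn {α : Type*} [MeasurableSpace α] {μ : Measure α}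
    [IsProbabilityMeasure μ] {X W : α → ℝ} {s : Set α} {B p : ℝ} (hp : 1 ≤ p)
    (hs : ∀ᵐ x ∂μ, x ∈ s) (hXm : AEStronglyMeasurable X μ) (hX : ∀ x ∈ s, |X x| ≤ B)
    (hW : Integrable W μ) (h : MonovaryOn X (W - X) s) :
    ∫⁻ x, ENNReal.ofReal (|X x - ∫ y, X y ∂μ| ^ p) ∂μ ≤
      ∫⁻ x, ENNReal.ofReal (|W x - ∫ y, W y ∂μ| ^ p) ∂μ := by
  have hXi : Integrable X μ := Integrable.of_bound hXm B (by filter_upwards [hs] with x hx using hX x hx)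
  set m := ∫ y, X y ∂μ with hm
  set n := ∫ y, W y ∂μ with hn
  have hp0 : 0 ≤ p := by linarith
  have hWm : AEStronglyMeasurable (fun x => |W x - n| ^ p) μ :=
    ((Real.continuous_rpow_const hp0).comp continuous_abs).comp_aestronglyMeasurable
      (hW.aestronglyMeasurable.sub aestronglyMeasurable_const)
  have hXm' : AEStronglyMeasurable (fun x => |X x - m| ^ p) μ :=
    ((Real.continuous_rpow_const hp0).comp continuous_abs).comp_aestronglyMeasurable
      (hXm.sub aestronglyMeasurable_const)
  by_cases htop : ∫⁻ x, ENNReal.ofReal (|W x - n| ^ p) ∂μ = ⊤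
  · rw [htop]; exact le_top
  have hWi : Integrable (fun x => |W x - n| ^ p) μ :=
    (lintegral_ofReal_ne_top_iff_integrable hWm (ae_of_all _ fun x => by positivity)).1 htop
  have hXbd : ∀ x ∈ s, |X x - m| ≤ B + |m| := fun x hx =>
    (abs_sub _ _).trans (by linarith [hX x hx])
  have hXpi : Integrable (fun x => |X x - m| ^ p) μ :=
    Integrable.of_bound hXm' ((B + |m|) ^ p) (by
      filter_upwards [hs] with x hx
      rw [Real.norm_of_nonneg (by positivity)]
      exact Real.rpow_le_rpow (abs_nonneg _) (hXbd x hx) hp0)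
  set Z : α → ℝ := fun x => absPowSubgrad p (X x - m) with hZ
  have hmono := monotone_absPowSubgrad hp
  have hZm : AEStronglyMeasurable Z μ :=
    (hmono.measurable.comp_aemeasurable
      (hXm.aemeasurable.sub aemeasurable_const)).aestronglyMeasurable
  have hZb : ∀ x ∈ s, |Z x| ≤ max |absPowSubgrad p (-(B + |m|))| |absPowSubgrad p (B + |m|)| := by
    intro x hx
    obtain ⟨h1, h2⟩ := abs_le.1 (hXbd x hx)
    exact abs_le_max_abs_abs (hmono h1) (hmono h2)
  have hZY : MonovaryOn Z (W - X) s := fun x hx y hy hxy =>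
    hmono (by linarith [h hx hy hxy])
  have hcheb := integral_mul_sub_average_nonneg hs hZm hZb (hW.sub hXi) hZY
  have hYi : Integrable (fun x => (W - X) x - ∫ y, (W - X) y ∂μ) μ :=
    (hW.sub hXi).sub (integrable_const _)
  have hZYi : Integrable (fun x => Z x * ((W - X) x - ∫ y, (W - X) y ∂μ)) μ :=
    hYi.bdd_mul hZm (by filter_upwards [hs] with x hx using hZb x hx)
  have hnm : ∫ y, (W - X) y ∂μ = n - m := integral_sub hW hXi
  rw [← ofReal_integral_eq_lintegral_ofReal hWi (ae_of_all _ fun x => by positivity),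
    ← ofReal_integral_eq_lintegral_ofReal hXpi (ae_of_all _ fun x => by positivity)]
  refine ENNReal.ofReal_le_ofReal ?_
  have hle : ∫ x, (|X x - m| ^ p + Z x * ((W - X) x - ∫ y, (W - X) y ∂μ)) ∂μ ≤
      ∫ x, |W x - n| ^ p ∂μ := by
    refine integral_mono (hXpi.add hZYi) hWi fun x => ?_
    have := abs_rpow_add_subgrad_le hp (X x - m) (W x - n)
    simp only [hZ]
    rw [hnm, Pi.sub_apply]
    refine le_trans (le_of_eq ?_) this
    ring
  rw [integral_add hXpi hZYi] at hle
  linarith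

/-! ### Truncation -/

/-- Truncation at the levels `-N` and `N`. -/
def trunc (N s : ℝ) : ℝ := max (-N) (min N s)

theorem monotone_trunc (N : ℝ) : Monotone (trunc N) := fun _ _ h =>
  max_le_max le_rfl (min_le_min le_rfl h)

theorem continuous_trunc (N : ℝ) : Continuous (trunc N) := by
  unfold trunc; fun_prop

theorem monotone_sub_trunc (N : ℝ) : Monotone fun s => s - trunc N s := by
  intro s t h
  simp only [trunc]
  grind

theorem abs_trunc_le {N : ℝ} (hN : 0 ≤ N) (s : ℝ) : |trunc N s| ≤ N := by
  rw [abs_le, trunc]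
  exact ⟨le_max_left _ _, max_le (by linarith) (min_le_left _ _)⟩

theorem abs_trunc_le_abs {N : ℝ} (hN : 0 ≤ N) (s : ℝ) : |trunc N s| ≤ |s| := by
  rw [abs_le, trunc]
  rcases abs_cases s with ⟨h, h'⟩ | ⟨h, h'⟩ <;> rw [h] <;> grind

theorem trunc_eq_self {N s : ℝ} (h : |s| ≤ N) : trunc N s = s := by
  rw [trunc, min_eq_right (abs_le.1 h).2, max_eq_right (abs_le.1 h).1]

theorem isProbabilityMeasure_average_Ioo {a b : ℝ} (hab : a < b) :
    IsProbabilityMeasure ((volume.restrict (Ioo a b) univ)⁻¹ • volume.restrict (Ioo a b)) := by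
  have : NeZero (volume.restrict (Ioo a b)) := ⟨by
    rw [Ne, Measure.restrict_eq_zero, Real.volume_Ioo]; simpa using hab⟩
  infer_instance

/-- `trunc N` and the remainder s - `trunc N s` are both nondecreasing, so φ is its truncation plus
a comonotone function. -/
theorem osc_trunc_le {p N : ℝ} (hp : 1 ≤ p) (hN : 0 ≤ N) {φ : ℝ → ℝ} {a b : ℝ} (hab : a < b)
    (hφ : IntegrableOn φ (Ioo a b)) : osc p (fun x => trunc N (φ x)) a b ≤ osc p φ a b := by
  have := isProbabilityMeasure_average_Ioo hab
  have hW : Integrable φ ((volume.restrict (Ioo a b) univ)⁻¹ • volume.restrict (Ioo a b)) :=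
    hφ.to_average
  refine ENNReal.rpow_le_rpow ?_ (by positivity)
  refine lintegral_osc_le_of_monovaryOn (s := univ) (B := N) hp (by simp)
    ((continuous_trunc N).comp_aestronglyMeasurable hW.aestronglyMeasurable)
    (fun x _ => abs_trunc_le hN _) hW ?_
  intro x _ y _ hxy
  by_contra! hlt
  have h1 : φ y < φ x := by
    by_contra! hle
    exact absurd (monotone_trunc N hle) (not_le.2 hlt)
  exact absurd (monotone_sub_trunc N h1.le) (not_le.2 hxy)

/-! ### The logarithm -/

/-- The `p`-th power of the norm of the logarithm. -/
noncomputable def logNormPow (p : ℝ) : ℝ :=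
  p / Real.exp 1 * (Real.Gamma p - ∫ t in (0 : ℝ)..1, t ^ (p - 1) * Real.exp t) + 1

theorem intervalIntegrable_rpow_mul_exp {q : ℝ} (hq : -1 < q) (a b : ℝ) :
    IntervalIntegrable (fun t : ℝ => t ^ q * Real.exp t) volume a b :=
  (intervalIntegral.intervalIntegrable_rpow' hq).mul_continuousOn Real.continuous_exp.continuousOn

theorem integral_rpow_mul_exp_by_parts {q : ℝ} (hq : 0 < q) :
    ∫ t in (0 : ℝ)..1, t ^ q * Real.exp t =
      Real.exp 1 - q * ∫ t in (0 : ℝ)..1, t ^ (q - 1) * Real.exp t := by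
  have h1 := intervalIntegrable_rpow_mul_exp (q := q) (by linarith) 0 1
  have h2 := intervalIntegrable_rpow_mul_exp (q := q - 1) (by linarith) 0 1
  have h := intervalIntegral.integral_eq_sub_of_hasDerivAt_of_le (a := 0) (b := 1)
    (f := fun t : ℝ => t ^ q * Real.exp t)
    (f' := fun t => q * (t ^ (q - 1) * Real.exp t) + t ^ q * Real.exp t) zero_le_one
    (((Real.continuous_rpow_const hq.le).mul Real.continuous_exp).continuousOn)
    (fun t ht => by
      have := (Real.hasDerivAt_rpow_const (p := q) (Or.inl ht.1.ne')).mul (Real.hasDerivAt_exp t)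
      exact this.congr_deriv (by ring))
    ((h2.const_mul q).add h1)
  rw [intervalIntegral.integral_add (h2.const_mul q) h1, intervalIntegral.integral_const_mul] at h
  simp only [Real.one_rpow, Real.zero_rpow hq.ne', one_mul, zero_mul, sub_zero] at h
  linarith

theorem integrableOn_abs_rpow_mul_exp_neg {q : ℝ} (hq : 0 ≤ q) (a : ℝ) :
    IntegrableOn (fun x : ℝ => |x| ^ q * Real.exp (-x)) (Ioi a) := by
  have h1 : IntegrableOn (fun x : ℝ => |x| ^ q * Real.exp (-x)) (Ioi 0) := by
    refine (Real.GammaIntegral_convergent (s := q + 1) (by linarith)).congr_fun (fun x hx => ?_)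
      measurableSet_Ioi
    simp only [abs_of_pos (mem_Ioi.1 hx), add_sub_cancel_right, mul_comm]
  have h2 : IntegrableOn (fun x : ℝ => |x| ^ q * Real.exp (-x)) (Icc a 0) := by
    refine ContinuousOn.integrableOn_Icc (Continuous.continuousOn ?_)
    exact ((Real.continuous_rpow_const hq).comp continuous_abs).mul (by fun_prop)
  refine (h2.union h1).mono_set fun x hx => ?_
  rcases le_or_gt x 0 with h | h
  · exact Or.inl ⟨le_of_lt hx, h⟩
  · exact Or.inr h

/-- Up to the factor e this is the p-th absolute central moment of a mean-one exponential variable,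
which is what identifies the closed form `logNormPow`. -/
theorem integral_abs_rpow_mul_exp_neg {p : ℝ} (hp : 0 < p) :
    ∫ x in Ioi (-1 : ℝ), |x| ^ p * Real.exp (-x) = Real.exp 1 * logNormPow p := by
  have hi := integrableOn_abs_rpow_mul_exp_neg hp.le (-1)
  have hsplit : Ioi (-1 : ℝ) = Ioc (-1) 0 ∪ Ioi 0 := (Ioc_union_Ioi_eq_Ioi (by norm_num)).symm
  rw [hsplit, setIntegral_union (Ioc_disjoint_Ioi le_rfl) measurableSet_Ioi
    (hi.mono_set Ioc_subset_Ioi_self) (hi.mono_set (Ioi_subset_Ioi (by norm_num))),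
    ← intervalIntegral.integral_of_le (by norm_num)]
  have h1 : ∫ x in (-1 : ℝ)..0, |x| ^ p * Real.exp (-x) = ∫ x in (0 : ℝ)..1, x ^ p * Real.exp x := by
    have := intervalIntegral.integral_comp_neg (a := -1) (b := 0) fun x : ℝ => |x| ^ p * Real.exp x
    simp only [abs_neg, neg_zero, neg_neg] at this
    rw [this]
    refine intervalIntegral.integral_congr fun x hx => ?_
    rw [uIcc_of_le zero_le_one] at hx
    simp only [abs_of_nonneg hx.1]
  have h2 : ∫ x in Ioi (0 : ℝ), |x| ^ p * Real.exp (-x) = p * Real.Gamma p := by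
    rw [← Real.Gamma_add_one hp.ne', Real.Gamma_eq_integral (by linarith)]
    refine setIntegral_congr_fun measurableSet_Ioi fun x hx => ?_
    simp only [abs_of_pos (mem_Ioi.1 hx), add_sub_cancel_right, mul_comm]
  rw [h1, h2, integral_rpow_mul_exp_by_parts hp, logNormPow]
  have := Real.exp_pos 1
  field_simp
  ring

theorem logNormPow_pos {p : ℝ} (hp : 0 < p) : 0 < logNormPow p := by
  have h1 : 0 ≤ ∫ t in (0 : ℝ)..1, t ^ p * Real.exp t :=
    intervalIntegral.integral_nonneg zero_le_one fun t ht =>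
      mul_nonneg (Real.rpow_nonneg ht.1 _) (Real.exp_pos _).le
  rw [integral_rpow_mul_exp_by_parts hp] at h1
  have h2 := mul_pos hp (Real.Gamma_pos_of_pos hp)
  have h3 : Real.exp 1 * logNormPow p = p * Real.Gamma p +
      (Real.exp 1 - p * ∫ t in (0 : ℝ)..1, t ^ (p - 1) * Real.exp t) := by
    rw [logNormPow]
    have := Real.exp_pos 1
    field_simp
    ring
  have h4 : 0 < Real.exp 1 * logNormPow p := by rw [h3]; linarith
  exact pos_of_mul_pos_right h4 (Real.exp_pos 1).le

theorem image_exp_neg_Ioi : (fun s : ℝ => Real.exp (-s)) '' Ioi 0 = Ioo 0 1 := by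
  ext t
  constructor
  · rintro ⟨s, hs, rfl⟩
    exact ⟨Real.exp_pos _, by simpa using hs⟩
  · rintro ⟨h0, h1⟩
    exact ⟨-Real.log t, by simpa using Real.log_neg h0 h1, by simp [Real.exp_log h0]⟩

theorem hasDerivAt_exp_neg (s : ℝ) :
    HasDerivAt (fun s : ℝ => Real.exp (-s)) (-Real.exp (-s)) s := by
  simpa using (hasDerivAt_neg s).exp

theorem injOn_exp_neg (A : Set ℝ) : InjOn (fun s : ℝ => Real.exp (-s)) A := fun x _ y _ h => by
  simpa using h

/-- The substitution `t = e^{-s}`. -/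
theorem integrableOn_comp_neg_log_iff (g : ℝ → ℝ) :
    IntegrableOn (fun t => g (-Real.log t)) (Ioo 0 1) ↔
      IntegrableOn (fun s => Real.exp (-s) * g s) (Ioi 0) := by
  rw [← image_exp_neg_Ioi, integrableOn_image_iff_integrableOn_abs_deriv_smul measurableSet_Ioi
    (fun x _ => (hasDerivAt_exp_neg x).hasDerivWithinAt) (injOn_exp_neg _)]
  simp [abs_of_pos (Real.exp_pos _)]

theorem integral_comp_neg_log (g : ℝ → ℝ) :
    ∫ t in Ioo 0 1, g (-Real.log t) = ∫ s in Ioi 0, Real.exp (-s) * g s := by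
  rw [← image_exp_neg_Ioi, integral_image_eq_integral_abs_deriv_smul measurableSet_Ioi
    (fun x _ => (hasDerivAt_exp_neg x).hasDerivWithinAt) (injOn_exp_neg _)]
  simp [abs_of_pos (Real.exp_pos _)]

theorem integrableOn_neg_log : IntegrableOn (fun t => -Real.log t) (Ioo 0 1) := by
  refine (integrableOn_comp_neg_log_iff fun s => s).2 ?_
  refine (Real.GammaIntegral_convergent (s := 2) (by norm_num)).congr_fun (fun x _ => ?_)
    measurableSet_Ioi
  norm_num

theorem integral_neg_log : ∫ t in Ioo (0 : ℝ) 1, -Real.log t = 1 := by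
  rw [integral_comp_neg_log fun s => s, ← Real.Gamma_two, Real.Gamma_eq_integral (by norm_num)]
  refine setIntegral_congr_fun measurableSet_Ioi fun x _ => ?_
  norm_num

theorem integral_abs_neg_log_sub_one {p : ℝ} (hp : 0 < p) :
    IntegrableOn (fun t => |-Real.log t - 1| ^ p) (Ioo 0 1) ∧
      ∫ t in Ioo (0 : ℝ) 1, |-Real.log t - 1| ^ p = logNormPow p := by
  have hshift : (fun s : ℝ => Real.exp (-s) * |s - 1| ^ p) =
      fun s => (fun x => Real.exp (-1) * (|x| ^ p * Real.exp (-x))) (s + -1) := by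
    ext s
    have : Real.exp (-s) = Real.exp (-1) * Real.exp (-(s + -1)) := by
      rw [← Real.exp_add]; ring_nf
    simp only [this, sub_eq_add_neg]; ring
  have hmp := measurePreserving_add_right (volume : Measure ℝ) (-1)
  have hemb : MeasurableEmbedding fun s : ℝ => s + -1 := measurableEmbedding_addRight _
  have hpre : (fun s : ℝ => s + -1) ⁻¹' Ioi (-1) = Ioi 0 := by ext; simp
  constructor
  · rw [integrableOn_comp_neg_log_iff fun s => |s - 1| ^ p, hshift, ← hpre]
    exact (hmp.integrableOn_comp_preimage hemb).2
      ((integrableOn_abs_rpow_mul_exp_neg hp.le (-1)).const_mul _)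
  · rw [integral_comp_neg_log fun s => |s - 1| ^ p, hshift, ← hpre,
      hmp.setIntegral_preimage_emb hemb (fun x => Real.exp (-1) * (|x| ^ p * Real.exp (-x))),
      integral_const_mul, integral_abs_rpow_mul_exp_neg hp,
      ← mul_assoc, ← Real.exp_add]
    simp

theorem lintegral_exp_neg_mul_log {δ : ℝ} (hδ : δ < 1) :
    ∫⁻ t in Ioo (0 : ℝ) 1, ENNReal.ofReal (Real.exp (-(δ * Real.log t))) =
      ENNReal.ofReal (1 / (1 - δ)) := by
  have h1 : ∀ s : ℝ, Real.exp (-s) * Real.exp (δ * s) = Real.exp (-(1 - δ) * s) := fun s => by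
    rw [← Real.exp_add]; ring_nf
  have hi : IntegrableOn (fun t => Real.exp (δ * -Real.log t)) (Ioo 0 1) := by
    rw [integrableOn_comp_neg_log_iff fun s => Real.exp (δ * s)]
    simp_rw [h1]
    exact exp_neg_integrableOn_Ioi 0 (by linarith)
  have h2 : ∫ t in Ioo (0 : ℝ) 1, Real.exp (δ * -Real.log t) = 1 / (1 - δ) := by
    rw [integral_comp_neg_log fun s => Real.exp (δ * s)]
    simp_rw [h1]
    rw [integral_exp_mul_Ioi (by linarith)]
    rw [neg_sub, mul_zero, Real.exp_zero, ← neg_sub 1 δ, neg_div_neg_eq]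
  simp_rw [show ∀ t : ℝ, -(δ * Real.log t) = δ * -Real.log t from fun t => by ring]
  rw [← ofReal_integral_eq_lintegral_ofReal hi (ae_of_all _ fun _ => (Real.exp_pos _).le), h2]

theorem lintegral_exp_neg_log_eq_top :
    ∫⁻ t in Ioo (0 : ℝ) 1, ENNReal.ofReal (Real.exp (-Real.log t)) = ⊤ := by
  have hni : ¬ IntegrableOn (fun t => Real.exp (-Real.log t)) (Ioo 0 1) := by
    rw [integrableOn_comp_neg_log_iff Real.exp]
    simp_rw [← Real.exp_add]
    simp
  by_contra h
  refine hni ((lintegral_ofReal_ne_top_iff_integrable ?_ (ae_of_all _ fun _ => (Real.exp_pos _).le)).1 h)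
  exact (Real.measurable_exp.comp Real.measurable_log.neg).aestronglyMeasurable

/-! ### Rescaling of averages -/

theorem image_affine_Ioo {a b : ℝ} (hab : a < b) :
    (fun t : ℝ => a + (b - a) * t) '' Ioo 0 1 = Ioo a b := by
  have h : 0 < b - a := sub_pos.2 hab
  ext x
  constructor
  · rintro ⟨t, ⟨h0, h1⟩, rfl⟩
    constructor <;> simp only <;> nlinarith
  · rintro ⟨h0, h1⟩
    refine ⟨(x - a) / (b - a), ⟨div_pos (by linarith) h, (div_lt_one h).2 (by linarith)⟩, ?_⟩
    field_simp
    ring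

theorem hasDerivAt_affine (a b t : ℝ) : HasDerivAt (fun t : ℝ => a + (b - a) * t) (b - a) t := by
  simpa using ((hasDerivAt_id t).const_mul (b - a)).const_add a

theorem injOn_affine {a b : ℝ} (hab : a < b) (A : Set ℝ) :
    InjOn (fun t : ℝ => a + (b - a) * t) A := fun x _ y _ h => by
  have : (b - a) * x = (b - a) * y := by simpa using h
  exact mul_left_cancel₀ (sub_pos.2 hab).ne' this

theorem average_Ioo_eq_integral {a b : ℝ} (hab : a < b) (g : ℝ → ℝ) :
    ⨍ t in Ioo a b, g t = ∫ t in Ioo 0 1, g (a + (b - a) * t) := by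
  have h : 0 < b - a := sub_pos.2 hab
  rw [setAverage_eq, ← image_affine_Ioo hab, integral_image_eq_integral_abs_deriv_smul measurableSet_Ioo
    (fun x _ => (hasDerivAt_affine a b x).hasDerivWithinAt) (injOn_affine hab _),
    image_affine_Ioo hab, Real.volume_real_Ioo_of_le hab.le]
  simp only [abs_of_pos h, smul_eq_mul]
  rw [integral_const_mul, ← mul_assoc, inv_mul_cancel₀ h.ne', one_mul]

theorem laverage_Ioo_eq_lintegral {a b : ℝ} (hab : a < b) (g : ℝ → ℝ≥0∞) :
    ⨍⁻ t in Ioo a b, g t ∂volume = ∫⁻ t in Ioo 0 1, g (a + (b - a) * t) := by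
  have h : 0 < b - a := sub_pos.2 hab
  have h' : ENNReal.ofReal (b - a) ≠ 0 := by simpa using h
  rw [setLAverage_eq, ← image_affine_Ioo hab, lintegral_image_eq_lintegral_abs_deriv_mul measurableSet_Ioo
    (fun x _ => (hasDerivAt_affine a b x).hasDerivWithinAt) (injOn_affine hab _),
    image_affine_Ioo hab, Real.volume_Ioo]
  simp only [abs_of_pos h]
  rw [lintegral_const_mul' _ _ ENNReal.ofReal_ne_top, mul_comm, mul_div_assoc, mul_comm,
    ENNReal.div_self h' ENNReal.ofReal_ne_top, one_mul]

/-! ### The norm of the logarithm -/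

/-- After rescaling to (0,1), an interval (0,b) only adds a constant to -log t. For a > 0, both
-log(a+(b-a)t) and what it lacks from -log t, namely log(a/t + b-a), are decreasing in t, so the
comonotone comparison applies. -/
theorem osc_neg_log_le {p : ℝ} (hp : 1 ≤ p) {a b : ℝ} (ha : 0 ≤ a) (hab : a < b) :
    osc p (fun t => -Real.log t) a b ≤ ENNReal.ofReal (logNormPow p ^ (1 / p)) := by
  have hp0 : 0 < p := by linarith
  have hh : 0 < b - a := sub_pos.2 hab
  rw [← ENNReal.ofReal_rpow_of_pos (logNormPow_pos hp0)]
  refine ENNReal.rpow_le_rpow ?_ (by positivity)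
  obtain ⟨hi, hI⟩ := integral_abs_neg_log_sub_one hp0
  rw [← hI, ofReal_integral_eq_lintegral_ofReal hi (ae_of_all _ fun _ => by positivity),
    average_Ioo_eq_integral hab, laverage_Ioo_eq_lintegral hab]
  have : IsProbabilityMeasure (volume.restrict (Ioo (0 : ℝ) 1)) := ⟨by simp⟩
  rcases ha.eq_or_lt with rfl | ha
  · have hb : 0 < b := hab
    have h1 : ∀ t ∈ Ioo (0 : ℝ) 1, -Real.log (0 + (b - 0) * t) = -Real.log t - Real.log b := by
      intro t ht
      rw [zero_add, sub_zero, Real.log_mul hb.ne' ht.1.ne']; ring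
    rw [setIntegral_congr_fun measurableSet_Ioo h1, integral_sub integrableOn_neg_log (by simp),
      integral_neg_log]
    refine le_of_eq (setLIntegral_congr_fun measurableSet_Ioo fun t ht => ?_)
    simp only [h1 t ht, integral_const, probReal_univ, smul_eq_mul]
    ring_nf
  · have h := lintegral_osc_le_of_monovaryOn (μ := volume.restrict (Ioo (0 : ℝ) 1))
      (X := fun t => -Real.log (a + (b - a) * t)) (W := fun t => -Real.log t) (s := Ioo 0 1)
      (B := max |-Real.log b| |-Real.log a|) hp
      (ae_restrict_mem measurableSet_Ioo)
      (Real.measurable_log.comp (by fun_prop)).neg.aestronglyMeasurable ?_ integrableOn_neg_log ?_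
    · rwa [integral_neg_log] at h
    · intro t ht
      have h1 : a ≤ a + (b - a) * t := by nlinarith [ht.1]
      have h2 : a + (b - a) * t ≤ b := by nlinarith [ht.2]
      exact abs_le_max_abs_abs (neg_le_neg (Real.log_le_log (by linarith) h2))
        (neg_le_neg (Real.log_le_log ha h1))
    · intro s hs t ht hst
      simp only [Pi.sub_apply] at hst
      have hs1 : 0 < a + (b - a) * s := by nlinarith [hs.1]
      have ht1 : 0 < a + (b - a) * t := by nlinarith [ht.1]
      have hlt : t < s := by
        by_contra! hle
        have h3 : (a + (b - a) * t) * s ≤ (a + (b - a) * s) * t := by nlinarith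
        have h4 := Real.log_le_log (mul_pos ht1 hs.1) h3
        rw [Real.log_mul ht1.ne' hs.1.ne', Real.log_mul hs1.ne' ht.1.ne'] at h4
        linarith
      exact neg_le_neg (Real.log_le_log ht1 (by nlinarith))

theorem osc_const_mul {p : ℝ} (hp : 0 < p) {δ : ℝ} (hδ : 0 ≤ δ) (φ : ℝ → ℝ) (a b : ℝ) :
    osc p (fun t => δ * φ t) a b = ENNReal.ofReal δ * osc p φ a b := by
  unfold osc
  have h1 : ∀ t, ENNReal.ofReal (|δ * φ t - ⨍ s in Ioo a b, δ * φ s| ^ p) =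
      ENNReal.ofReal δ ^ p * ENNReal.ofReal (|φ t - ⨍ s in Ioo a b, φ s| ^ p) := by
    intro t
    have : ⨍ s in Ioo a b, δ * φ s = δ * ⨍ s in Ioo a b, φ s := integral_const_mul _ _
    rw [this, ← mul_sub, abs_mul, abs_of_nonneg hδ, Real.mul_rpow hδ (abs_nonneg _),
      ENNReal.ofReal_mul (by positivity), ENNReal.ofReal_rpow_of_nonneg hδ hp.le]
  simp_rw [h1]
  rw [laverage, lintegral_const_mul' _ _ (ENNReal.rpow_ne_top_of_nonneg hp.le ENNReal.ofReal_ne_top),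
    ENNReal.mul_rpow_of_nonneg _ _ (by positivity), ← ENNReal.rpow_mul, mul_one_div_cancel hp.ne',
    ENNReal.rpow_one, laverage]

theorem bmoNorm_const_mul_neg_log_le {p : ℝ} (hp : 1 ≤ p) {δ : ℝ} (hδ : 0 ≤ δ) :
    bmoNorm p (fun t => δ * -Real.log t) ≤ ENNReal.ofReal (δ * logNormPow p ^ (1 / p)) := by
  refine iSup₂_le fun a b => iSup₂_le fun ha hab => iSup_le fun _ => ?_
  rw [osc_const_mul (by linarith) hδ, ENNReal.ofReal_mul hδ]
  gcongr
  exact osc_neg_log_le hp ha hab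

theorem memBMO_const_mul_neg_log {p : ℝ} (hp : 1 ≤ p) {δ : ℝ} (hδ : 0 ≤ δ) :
    MemBMO p (fun t => δ * -Real.log t) :=
  ⟨integrableOn_neg_log.const_mul δ,
    (bmoNorm_const_mul_neg_log_le hp hδ).trans_lt ENNReal.ofReal_lt_top⟩

/-- Admissible constants are bounded below by the value at multiples of the logarithm. -/
theorem le_of_isJNBound {p : ℝ} (hp : 1 ≤ p) {δ : ℝ} (hδ0 : 0 ≤ δ) (hδ1 : δ < 1) {K : ℝ≥0∞}
    (hK : IsJNBound p (δ * logNormPow p ^ (1 / p)) K) :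
    ENNReal.ofReal (Real.exp (-δ) / (1 - δ)) ≤ K := by
  have h := hK _ (memBMO_const_mul_neg_log hp hδ0) (bmoNorm_const_mul_neg_log_le hp hδ0) 0 1 le_rfl
    one_pos le_rfl
  rw [laverage_Ioo_eq_lintegral one_pos, average_Ioo_eq_integral one_pos] at h
  simp only [zero_add, sub_zero, one_mul, mul_neg, lintegral_exp_neg_mul_log hδ1] at h
  simp_rw [← mul_neg] at h
  rw [integral_const_mul, integral_neg_log, mul_one] at h
  calc ENNReal.ofReal (Real.exp (-δ) / (1 - δ))
      = ENNReal.ofReal (1 / (1 - δ)) * ENNReal.ofReal (Real.exp (-δ)) := by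
        rw [← ENNReal.ofReal_mul (by
          exact div_nonneg zero_le_one (by linarith))]
        congr 1; ring
    _ ≤ K * ENNReal.ofReal (Real.exp δ) * ENNReal.ofReal (Real.exp (-δ)) := by gcongr
    _ = K := by
        rw [mul_assoc, ← ENNReal.ofReal_mul (Real.exp_pos _).le, ← Real.exp_add]; simp

/-- At δ = 1 the exponential of the logarithm is 1/t, which is not integrable. -/
theorem eq_top_of_isJNBound {p : ℝ} (hp : 1 ≤ p) {K : ℝ≥0∞}
    (hK : IsJNBound p (logNormPow p ^ (1 / p)) K) : K = ⊤ := by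
  have h := hK (fun t => 1 * -Real.log t) (memBMO_const_mul_neg_log hp zero_le_one)
    (by simpa using bmoNorm_const_mul_neg_log_le hp zero_le_one) 0 1 le_rfl one_pos le_rfl
  rw [laverage_Ioo_eq_lintegral one_pos] at h
  simp only [zero_add, sub_zero, one_mul, lintegral_exp_neg_log_eq_top, top_le_iff] at h
  by_contra hne
  exact ENNReal.mul_ne_top hne ENNReal.ofReal_ne_top h

/-! ### The tail of the Gamma integral -/

theorem intervalIntegrable_abs_rpow {q : ℝ} (hq : -1 < q) (a b : ℝ) :
    IntervalIntegrable (fun x : ℝ => |x| ^ q) volume a b := by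
  refine intervalIntegrable_of_even (fun x => by simp) (fun x hx => ?_)
  refine (intervalIntegral.intervalIntegrable_rpow' (a := 0) (b := x) hq).congr ?_
  intro t ht
  rw [uIoc_of_le hx.le] at ht
  simp only [abs_of_pos ht.1]

theorem intervalIntegrable_abs_rpow_mul_exp_neg {q : ℝ} (hq : -1 < q) (a b : ℝ) :
    IntervalIntegrable (fun x : ℝ => |x| ^ q * Real.exp (-x)) volume a b :=
  (intervalIntegrable_abs_rpow hq a b).mul_continuousOn (by fun_prop)

/-- The function `∫_w^∞ |x|^(p-2) e^{-x} dx`. -/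
noncomputable def gammaTail (p w : ℝ) : ℝ :=
  Real.Gamma (p - 1) - ∫ x in (0 : ℝ)..w, |x| ^ (p - 2) * Real.exp (-x)

theorem continuous_gammaTail {p : ℝ} (hp : 1 < p) : Continuous (gammaTail p) :=
  continuous_const.sub (intervalIntegral.continuous_primitive
    (fun a b => intervalIntegrable_abs_rpow_mul_exp_neg (by linarith) a b) 0)

theorem hasDerivAt_gammaTail {p : ℝ} (hp : 1 < p) {w : ℝ} (hw : w ≠ 0) :
    HasDerivAt (gammaTail p) (-(|w| ^ (p - 2) * Real.exp (-w))) w := by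
  refine (intervalIntegral.integral_hasDerivAt_right
    (intervalIntegrable_abs_rpow_mul_exp_neg (by linarith) 0 w) ?_ ?_).const_sub _
  · refine Measurable.stronglyMeasurable ?_ |>.stronglyMeasurableAtFilter
    fun_prop
  · exact (continuous_abs.continuousAt.rpow_const (Or.inl (abs_pos.2 hw).ne')).mul (by fun_prop)

theorem gammaTail_of_pos {p w : ℝ} (hp : 1 < p) (hw : 0 < w) :
    gammaTail p w = ∫ x in Ioi w, x ^ (p - 2) * Real.exp (-x) ∧
      IntegrableOn (fun x => x ^ (p - 2) * Real.exp (-x)) (Ioi w) := by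
  have hi : IntegrableOn (fun x => x ^ (p - 2) * Real.exp (-x)) (Ioi 0) :=
    (Real.GammaIntegral_convergent (s := p - 1) (by linarith)).congr_fun
      (fun x _ => by rw [mul_comm]; ring_nf) measurableSet_Ioi
  have hw' : IntegrableOn (fun x => x ^ (p - 2) * Real.exp (-x)) (Ioi w) :=
    hi.mono_set (Ioi_subset_Ioi hw.le)
  refine ⟨?_, hw'⟩
  have h1 : Real.Gamma (p - 1) = ∫ x in Ioi 0, x ^ (p - 2) * Real.exp (-x) := by
    rw [Real.Gamma_eq_integral (by linarith)]
    refine setIntegral_congr_fun measurableSet_Ioi fun x _ => ?_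
    rw [mul_comm]; ring_nf
  have h2 : ∫ x in (0 : ℝ)..w, |x| ^ (p - 2) * Real.exp (-x) =
      ∫ x in (0 : ℝ)..w, x ^ (p - 2) * Real.exp (-x) := by
    refine intervalIntegral.integral_congr fun x hx => ?_
    rw [uIcc_of_le hw.le] at hx
    simp only [abs_of_nonneg hx.1]
  have h3 := intervalIntegral.integral_interval_add_Ioi hi hw'
  rw [gammaTail, h1, h2]
  linarith

theorem gammaTail_le_of_pos {p w : ℝ} (hp : 1 < p) (hp2 : p ≤ 2) (hw : 0 < w) :
    gammaTail p w ≤ w ^ (p - 2) * Real.exp (-w) := by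
  obtain ⟨h, hi⟩ := gammaTail_of_pos hp hw
  rw [h, ← integral_exp_neg_Ioi w, ← integral_const_mul]
  refine setIntegral_mono_on hi ((integrableOn_exp_neg_Ioi w).const_mul _) measurableSet_Ioi
    fun x hx => ?_
  exact mul_le_mul_of_nonneg_right (Real.rpow_le_rpow_of_nonpos hw (le_of_lt hx) (by linarith))
    (Real.exp_pos _).le

theorem gammaTail_nonneg {p : ℝ} (hp : 1 < p) (w : ℝ) : 0 ≤ gammaTail p w := by
  rcases le_or_gt w 0 with hw | hw
  · rw [gammaTail, intervalIntegral.integral_symm]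
    have h1 : 0 ≤ ∫ x in w..0, |x| ^ (p - 2) * Real.exp (-x) :=
      intervalIntegral.integral_nonneg hw fun x _ => by positivity
    have h2 := Real.Gamma_pos_of_pos (show 0 < p - 1 by linarith)
    linarith
  · rw [(gammaTail_of_pos hp hw).1]
    refine setIntegral_nonneg measurableSet_Ioi fun x hx => ?_
    have : 0 < x := hw.trans hx
    positivity

/-- The tail at the foot -1 carries the constant of the theorem: p(p-1)e^{-1} times it equals p - 1
+ `logNormPow p`. -/
theorem gammaTail_neg_one {p : ℝ} (hp : 1 < p) :
    (p - 1) * gammaTail p (-1) =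
      Real.Gamma p + Real.exp 1 - ∫ t in (0 : ℝ)..1, t ^ (p - 1) * Real.exp t := by
  have h1 : ∫ x in (0 : ℝ)..(-1), |x| ^ (p - 2) * Real.exp (-x) =
      -∫ t in (0 : ℝ)..1, t ^ (p - 2) * Real.exp t := by
    rw [intervalIntegral.integral_symm]
    have := intervalIntegral.integral_comp_neg (a := -1) (b := 0)
      fun x : ℝ => |x| ^ (p - 2) * Real.exp x
    simp only [abs_neg, neg_zero, neg_neg] at this
    rw [this]
    congr 1
    refine intervalIntegral.integral_congr fun x hx => ?_
    rw [uIcc_of_le zero_le_one] at hx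
    simp only [abs_of_nonneg hx.1]
  have h2 := integral_rpow_mul_exp_by_parts (q := p - 1) (by linarith)
  have h3 := Real.Gamma_add_one (s := p - 1) (by linarith)
  rw [sub_add_cancel] at h3
  rw [show p - 1 - 1 = p - 2 by ring] at h2
  rw [gammaTail, h1, h2, h3]
  ring

theorem gamma_le_one {p : ℝ} (hp : 1 ≤ p) (hp2 : p ≤ 2) : Real.Gamma p ≤ 1 := by
  have h := Real.convexOn_Gamma.2 (show (1 : ℝ) ∈ Ioi 0 by simp) (show (2 : ℝ) ∈ Ioi 0 by simp)
    (show 0 ≤ 2 - p by linarith) (show 0 ≤ p - 1 by linarith) (by ring)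
  simp only [smul_eq_mul, Real.Gamma_one, Real.Gamma_two] at h
  rw [show (2 - p) * 1 + (p - 1) * 2 = p by ring] at h
  linarith

theorem one_le_integral_rpow_mul_exp {p : ℝ} (hp : 1 ≤ p) (hp2 : p ≤ 2) :
    1 ≤ ∫ t in (0 : ℝ)..1, t ^ (p - 1) * Real.exp t := by
  have h1 : ∫ t in (0 : ℝ)..1, t ^ (1 : ℝ) * Real.exp t = 1 := by
    rw [integral_rpow_mul_exp_by_parts one_pos]
    simp
  have h2 : ∫ t in (0 : ℝ)..1, t ^ (1 : ℝ) * Real.exp t ≤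
      ∫ t in (0 : ℝ)..1, t ^ (p - 1) * Real.exp t := by
    refine intervalIntegral.integral_mono_on_of_le_Ioo zero_le_one
      (intervalIntegrable_rpow_mul_exp (by norm_num) 0 1)
      (intervalIntegrable_rpow_mul_exp (by linarith) 0 1) fun t ht => ?_
    exact mul_le_mul_of_nonneg_right
      (Real.rpow_le_rpow_of_exponent_ge ht.1 ht.2.le (by linarith)) (Real.exp_pos _).le
  rwa [h1] at h2

/-- With u = -w, the difference j(u) has derivative (2-p)u^{p-3}e^u(u-1), so its minimum is j(1) =
∫₀¹t^{p-1}e^t dt - Γ(p). There the integral is at least 1 and Γ(p) at most 1. -/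
theorem gammaTail_le_of_neg {p w : ℝ} (hp : 1 < p) (hp2 : p ≤ 2) (hw : w < 0) :
    (p - 1) * gammaTail p w ≤ |w| ^ (p - 2) * Real.exp (-w) := by
  set j : ℝ → ℝ := fun u => u ^ (p - 2) * Real.exp u - (p - 1) * gammaTail p (-u) with hj
  have hd : ∀ u : ℝ, 0 < u →
      HasDerivAt j ((2 - p) * u ^ (p - 3) * Real.exp u * (u - 1)) u := by
    intro u hu
    have h1 := (Real.hasDerivAt_rpow_const (x := u) (p := p - 2) (Or.inl hu.ne')).mul
      (Real.hasDerivAt_exp u)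
    have h2 : HasDerivAt (fun u => gammaTail p (-u)) (u ^ (p - 2) * Real.exp u) u := by
      have := (hasDerivAt_gammaTail hp (neg_ne_zero.2 hu.ne')).comp u (hasDerivAt_neg u)
      exact this.congr_deriv (by simp [abs_of_pos hu])
    refine (h1.sub (h2.const_mul (p - 1))).congr_deriv ?_
    rw [show p - 2 = p - 3 + 1 by ring, Real.rpow_add_one hu.ne', add_sub_cancel_right]
    ring
  have hj1 : 0 ≤ j 1 := by
    have h1 := gammaTail_neg_one hp
    have h2 := gamma_le_one hp.le hp2
    have h3 := one_le_integral_rpow_mul_exp hp.le hp2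
    simp only [hj, Real.one_rpow, h1]
    linarith
  have hju : ∀ u, 0 < u → 0 ≤ j u := by
    intro u hu
    refine hj1.trans ?_
    rcases le_total u 1 with h | h
    · have hanti : AntitoneOn j (Icc u 1) := by
        refine antitoneOn_of_deriv_nonpos (convex_Icc u 1)
          (fun x hx => (hd x (hu.trans_le hx.1)).continuousAt.continuousWithinAt)
          (fun x hx => ?_) fun x hx => ?_
        · rw [interior_Icc] at hx
          exact (hd x (hu.trans hx.1)).differentiableAt.differentiableWithinAt
        · rw [interior_Icc] at hx
          have hx0 : 0 < x := hu.trans hx.1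
          rw [(hd x hx0).deriv]
          have : 0 ≤ (2 - p) * x ^ (p - 3) * Real.exp x :=
            mul_nonneg (mul_nonneg (by linarith) (by positivity)) (Real.exp_pos _).le
          exact mul_nonpos_of_nonneg_of_nonpos this (by linarith [hx.2])
      exact hanti (left_mem_Icc.2 h) (right_mem_Icc.2 h) h
    · have hmono : MonotoneOn j (Icc 1 u) := by
        refine monotoneOn_of_deriv_nonneg (convex_Icc 1 u)
          (fun x hx => (hd x (one_pos.trans_le hx.1)).continuousAt.continuousWithinAt)
          (fun x hx => ?_) fun x hx => ?_
        · rw [interior_Icc] at hx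
          exact (hd x (one_pos.trans hx.1)).differentiableAt.differentiableWithinAt
        · rw [interior_Icc] at hx
          have hx0 : 0 < x := one_pos.trans hx.1
          rw [(hd x hx0).deriv]
          have : 0 ≤ (2 - p) * x ^ (p - 3) * Real.exp x :=
            mul_nonneg (mul_nonneg (by linarith) (by positivity)) (Real.exp_pos _).le
          exact mul_nonneg this (by linarith [hx.1])
      exact hmono (left_mem_Icc.2 h) (right_mem_Icc.2 h) h
  have := hju (-w) (by linarith)
  simp only [hj, neg_neg] at this
  rw [abs_of_neg hw]
  linarith

/-! ### The tangent family for `|s|^p` -/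

/-- The density of the measure representing `|s|^p` over the tangents. -/
noncomputable def tangentDensity (p δ w : ℝ) : ℝ :=
  p * (p - 1) * (|w| ^ (p - 2) - (1 - δ) * Real.exp w * gammaTail p w)

/-- The hypothesis 2-p ≤ δ enters here: it says 1-δ ≤ p-1, the factor available in the tail bound at
negative w. For positive w, 1-δ ≤ 1 already suffices. -/
theorem tangentDensity_nonneg {p δ w : ℝ} (hp : 1 < p) (hp2 : p ≤ 2) (hδ : 2 - p ≤ δ)
    (hw : w ≠ 0) : 0 ≤ tangentDensity p δ w := by
  have hK := gammaTail_nonneg hp w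
  have he : Real.exp w * Real.exp (-w) = 1 := by rw [← Real.exp_add]; simp
  have hew := Real.exp_pos w
  have key : (1 - δ) * gammaTail p w ≤ |w| ^ (p - 2) * Real.exp (-w) := by
    rcases lt_or_gt_of_ne hw with h | h
    · refine le_trans ?_ (gammaTail_le_of_neg hp hp2 h)
      exact mul_le_mul_of_nonneg_right (by linarith) hK
    · have := gammaTail_le_of_pos hp hp2 h
      rw [abs_of_pos h]
      refine le_trans ?_ this
      nlinarith
  refine mul_nonneg (mul_nonneg (by linarith) (by linarith)) (sub_nonneg.2 ?_)
  calc (1 - δ) * Real.exp w * gammaTail p w = Real.exp w * ((1 - δ) * gammaTail p w) := by ring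
    _ ≤ Real.exp w * (|w| ^ (p - 2) * Real.exp (-w)) := by gcongr
    _ = |w| ^ (p - 2) * (Real.exp w * Real.exp (-w)) := by ring
    _ = |w| ^ (p - 2) := by rw [he, mul_one]

theorem intervalIntegrable_tangentDensity {p : ℝ} (hp : 1 < p) (δ a b : ℝ) :
    IntervalIntegrable (tangentDensity p δ) volume a b := by
  refine ((intervalIntegrable_abs_rpow (by linarith) a b).sub ?_).const_mul _
  exact Continuous.intervalIntegrable
    ((continuous_const.mul Real.continuous_exp).mul (continuous_gammaTail hp)) a b

/-- The tangent function with foot `w`, evaluated at the boundary point with abscissa `s`. -/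
noncomputable def tangentFun (p δ s w : ℝ) : ℝ :=
  δ ^ 2 * |w| ^ p + δ ^ 2 * (p * |w| ^ (p - 2) * w) * (s - w) +
    (1 - δ) * (p * (p - 1)) * (Real.exp w * gammaTail p w) *
      (Real.exp (δ * (s - w)) - 1 - δ * (s - w))

theorem continuous_abs_rpow_mul {p : ℝ} (hp : 1 < p) :
    Continuous fun w : ℝ => |w| ^ (p - 2) * w := by
  have h : ∀ w : ℝ, |(|w| ^ (p - 2) * w)| = |w| ^ (p - 1) := by
    intro w
    rcases eq_or_ne w 0 with rfl | hw
    · simp [Real.zero_rpow (show p - 1 ≠ 0 by linarith)]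
    · rw [abs_mul, abs_of_nonneg (by positivity : (0:ℝ) ≤ |w| ^ (p - 2)),
        ← Real.rpow_add_one (abs_pos.2 hw).ne']
      congr 1; ring
  rw [continuous_iff_continuousAt]
  intro w
  rcases eq_or_ne w 0 with rfl | hw
  · rw [ContinuousAt, mul_zero, tendsto_zero_iff_abs_tendsto_zero]
    have h1 : Continuous fun w : ℝ => |w| ^ (p - 1) :=
      (Real.continuous_rpow_const (by linarith)).comp continuous_abs
    have h2 := h1.tendsto 0
    rw [abs_zero, Real.zero_rpow (by linarith)] at h2
    exact h2.congr fun w => (h w).symm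
  · exact (continuous_abs.continuousAt.rpow_const (Or.inl (abs_pos.2 hw).ne')).mul continuousAt_id

theorem hasDerivAt_abs_rpow_mul {p w : ℝ} (hw : w ≠ 0) :
    HasDerivAt (fun w : ℝ => |w| ^ (p - 2) * w) ((p - 1) * |w| ^ (p - 2)) w := by
  have h1 := ((hasDerivAt_abs hw).rpow_const (p := p - 2) (Or.inl (abs_pos.2 hw).ne')).mul
    (hasDerivAt_id w)
  refine h1.congr_deriv ?_
  have h2 : |w| ^ (p - 2) = |w| ^ (p - 2 - 1) * |w| := by
    rw [← Real.rpow_add_one (abs_pos.2 hw).ne']; ring_nf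
  have h3 : (SignType.sign w : ℝ) * w = |w| := by
    rcases lt_or_gt_of_ne hw with h | h
    · simp [sign_neg h, abs_of_neg h]
    · simp [sign_pos h, abs_of_pos h]
  simp only [id, mul_one]
  rw [h2]
  linear_combination (p - 2) * |w| ^ (p - 2 - 1) * h3

/-- The coefficient y = e^w `gammaTail p w` solves y' = y - |w|^{p-2}; this is the equation that
makes the w-derivative factor as a density in w times the gap. -/
theorem hasDerivAt_tangentFun {p δ s w : ℝ} (hp : 1 < p) (hw : w ≠ 0) :
    HasDerivAt (tangentFun p δ s) (tangentDensity p δ w * gap δ (δ * (s - w))) w := by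
  have h1 := (hasDerivAt_abs_rpow w hp).const_mul (δ ^ 2)
  have h2 := ((hasDerivAt_abs_rpow_mul (p := p) hw).const_mul p).const_mul (δ ^ 2)
  have h3 : HasDerivAt (fun w => s - w) (-1) w := by simpa using (hasDerivAt_id w).const_sub s
  have h4 := ((Real.hasDerivAt_exp w).mul (hasDerivAt_gammaTail hp hw)).const_mul
    ((1 - δ) * (p * (p - 1)))
  have h5 := h3.const_mul δ
  have h6 := ((h5.exp).sub_const 1).sub h5
  have h := (h1.add (h2.mul h3)).add (h4.mul h6)
  have he : Real.exp w * Real.exp (-w) = 1 := by rw [← Real.exp_add]; simp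
  refine (h.congr_of_eventuallyEq (Eventually.of_forall fun x => ?_)).congr_deriv ?_
  · simp only [tangentFun, Pi.add_apply, Pi.mul_apply, Pi.sub_apply]
    ring
  · simp only [tangentDensity, gap, Pi.mul_apply, Pi.sub_apply]
    linear_combination (-(1 - δ) * (p * (p - 1)) * |w| ^ (p - 2) *
      (Real.exp (δ * (s - w)) - 1 - δ * (s - w))) * he

theorem continuous_tangentFun {p : ℝ} (hp : 1 < p) (δ s : ℝ) : Continuous (tangentFun p δ s) := by
  have h1 : Continuous fun w : ℝ => |w| ^ p :=
    (Real.continuous_rpow_const (by linarith)).comp continuous_abs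
  have h2 := continuous_abs_rpow_mul hp
  have h3 := continuous_gammaTail hp
  have h4 : tangentFun p δ s = fun w => δ ^ 2 * |w| ^ p +
      δ ^ 2 * (p * (|w| ^ (p - 2) * w)) * (s - w) + (1 - δ) * (p * (p - 1)) *
      (Real.exp w * gammaTail p w) * (Real.exp (δ * (s - w)) - 1 - δ * (s - w)) := by
    ext w; rw [tangentFun]; ring
  rw [h4]
  fun_prop

theorem intervalIntegrable_tangentDensity_mul_gap {p : ℝ} (hp : 1 < p) (δ s a b : ℝ) :
    IntervalIntegrable (fun w => tangentDensity p δ w * gap δ (δ * (s - w))) volume a b :=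
  (intervalIntegrable_tangentDensity hp δ a b).mul_continuousOn
    (((continuous_gap δ).comp (by fun_prop)).continuousOn)

/-- Representation of `|s|^p` through its tangents. -/
theorem integral_tangentDensity_mul_gap {p : ℝ} (hp : 1 < p) (δ s : ℝ) :
    ∫ w in (-1 : ℝ)..s, tangentDensity p δ w * gap δ (δ * (s - w)) =
      δ ^ 2 * |s| ^ p - tangentFun p δ s (-1) := by
  -- The foot w = 0 is excepted, since |w|^{p-2} is singular there when p < 2. At w = s the tangent
  -- function equals δ²|s|^p.
  rw [integral_eq_of_hasDerivAt_off_countable (tangentFun p δ s) _ (countable_singleton 0)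
    (continuous_tangentFun hp δ s).continuousOn
    (fun x hx => hasDerivAt_tangentFun hp hx.2)
    (intervalIntegrable_tangentDensity_mul_gap hp δ s _ _)]
  simp [tangentFun]

/-- For s ≥ -1 this is the exact representation. For s < -1 the integral over levels is empty, and
the representation's integral from s to -1 has nonpositive integrand, so discarding it leaves an
inequality. -/
theorem tangentFun_add_integral_le {p δ s M : ℝ} (hp : 1 < p) (hp2 : p ≤ 2) (hδ : 2 - p ≤ δ)
    (hδ0 : 0 ≤ δ) (hδ1 : δ ≤ 1) (hs : s ≤ M) :
    tangentFun p δ s (-1) + ∫ w in Ioc (-1) M,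
      tangentDensity p δ w * (Iio s).indicator (fun w => gap δ (δ * (s - w))) w ≤
      δ ^ 2 * |s| ^ p := by
  have h := integral_tangentDensity_mul_gap hp δ s
  have heq : ∫ w in Ioc (-1) M,
      tangentDensity p δ w * (Iio s).indicator (fun w => gap δ (δ * (s - w))) w =
      ∫ w in Ioo (-1) s, tangentDensity p δ w * gap δ (δ * (s - w)) := by
    have : ∀ w, tangentDensity p δ w * (Iio s).indicator (fun w => gap δ (δ * (s - w))) w =
        (Iio s).indicator (fun w => tangentDensity p δ w * gap δ (δ * (s - w))) w := by
      intro w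
      by_cases hw : w ∈ Iio s <;> simp [hw]
    simp_rw [this]
    rw [setIntegral_indicator measurableSet_Iio]
    congr 2
    ext w
    simp only [mem_inter_iff, mem_Ioc, mem_Iio, mem_Ioo]
    exact ⟨fun h => ⟨h.1.1, h.2⟩, fun h => ⟨⟨h.1, h.2.le.trans hs⟩, h.2⟩⟩
  rw [heq]
  rcases le_total (-1) s with hs1 | hs1
  · rw [intervalIntegral.integral_of_le hs1, integral_Ioc_eq_integral_Ioo] at h
    linarith
  · rw [Ioo_eq_empty (not_lt.2 hs1), setIntegral_empty, add_zero]
    rw [intervalIntegral.integral_symm] at h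
    have : ∫ w in s..(-1), tangentDensity p δ w * gap δ (δ * (s - w)) ≤ 0 := by
      rw [← neg_nonneg, ← intervalIntegral.integral_neg]
      refine intervalIntegral.integral_nonneg hs1 fun w hw => ?_
      rw [neg_nonneg]
      refine mul_nonpos_of_nonneg_of_nonpos (tangentDensity_nonneg hp hp2 hδ ?_)
        (gap_nonpos_of_nonpos hδ0 hδ1 ?_)
      · have := hw.2; intro h0; linarith
      · exact mul_nonpos_of_nonneg_of_nonpos hδ0 (by linarith [hw.1])
    linarith

theorem integrable_tangentDensity_mul_indicator {p δ N : ℝ} (hp : 1 < p) {φ : ℝ → ℝ}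
    (hφ : Measurable φ) (hN : ∀ x, |φ x| ≤ N) (a b M : ℝ) (hM : -1 ≤ M) :
    Integrable (fun z : ℝ × ℝ => tangentDensity p δ z.2 *
      {z : ℝ × ℝ | δ * z.2 < φ z.1}.indicator (fun z => gap δ (φ z.1 - δ * z.2)) z)
      ((volume.restrict (Ioo a b)).prod (volume.restrict (Ioc (-1) M))) := by
  obtain ⟨B, hB⟩ := (isCompact_Icc (a := -N) (b := N)).prod (isCompact_Icc (a := -1) (b := M))
    |>.exists_bound_of_continuousOn (f := fun z : ℝ × ℝ => gap δ (z.1 - δ * z.2))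
      ((continuous_gap δ).comp (by fun_prop)).continuousOn
  have hd : Integrable (fun z : ℝ × ℝ => tangentDensity p δ z.2)
      ((volume.restrict (Ioo a b)).prod (volume.restrict (Ioc (-1) M))) :=
    Integrable.comp_snd ((intervalIntegrable_iff_integrableOn_Ioc_of_le hM).1
      (intervalIntegrable_tangentDensity hp δ _ _)) _
  have hset : MeasurableSet {z : ℝ × ℝ | δ * z.2 < φ z.1} :=
    measurableSet_lt (measurable_snd.const_mul δ) (hφ.comp measurable_fst)
  refine hd.mul_bdd (c := B) ?_ ?_
  · refine (Measurable.indicator ?_ hset).aestronglyMeasurable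
    exact (continuous_gap δ).measurable.comp
      ((hφ.comp measurable_fst).sub (measurable_snd.const_mul δ))
  · rw [Measure.prod_restrict]
    filter_upwards [ae_restrict_mem (measurableSet_Ioo.prod measurableSet_Ioc)] with z hz
    have h := hB (φ z.1, z.2) ⟨abs_le.1 (hN _), ⟨hz.2.1.le, hz.2.2⟩⟩
    exact (norm_indicator_le_norm_self _ _).trans h

theorem integral_tangentFun_le {p δ N C : ℝ} (hp : 1 < p) (hp2 : p ≤ 2) (hδ : 2 - p ≤ δ)
    (hδ0 : 0 < δ) (hδ1 : δ < 1) (hCδ : Real.exp (-δ) = C * (1 - δ)) {φ : ℝ → ℝ} (hφ : Measurable φ)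
    (hN : ∀ x, |φ x| ≤ N) {a b : ℝ} (hab : a ≤ b) (hC : ExpBound C φ a b)
    (hm : ∫ x in Ioo a b, φ x = 0) :
    ∫ x in Ioo a b, tangentFun p δ (φ x / δ) (-1) ≤ ∫ x in Ioo a b, δ ^ 2 * |φ x / δ| ^ p := by
  have hN0 : 0 ≤ N := (abs_nonneg _).trans (hN 0)
  -- M bounds φ/δ from above, so levels w above M contribute nothing and Fubini is applied on a
  -- bounded range.
  set M := N / δ with hM
  have hM0 : -1 ≤ M := le_trans (by norm_num) (div_nonneg hN0 hδ0.le)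
  have hF := integrable_tangentDensity_mul_indicator (δ := δ) hp hφ hN a b M hM0
  set F : ℝ → ℝ → ℝ := fun x w => tangentDensity p δ w *
      {z : ℝ × ℝ | δ * z.2 < φ z.1}.indicator (fun z => gap δ (φ z.1 - δ * z.2)) (x, w) with hFdef
  have hF' : Integrable (Function.uncurry F)
      ((volume.restrict (Ioo a b)).prod (volume.restrict (Ioc (-1) M))) := hF
  have hswap := integral_integral_swap hF'
  have hpos : 0 ≤ ∫ x in Ioo a b, ∫ w in Ioc (-1) M, F x w := by
    rw [hswap]
    have h0 : ∀ᵐ w : ℝ, w ≠ 0 := by simp [ae_iff, measure_singleton]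
    refine integral_nonneg_of_ae ?_
    filter_upwards [ae_restrict_mem measurableSet_Ioc, ae_restrict_of_ae h0] with w hw hw0
    simp only [hFdef]
    rw [integral_const_mul]
    refine mul_nonneg (tangentDensity_nonneg hp hp2 hδ hw0) ?_
    -- The level δw is admissible for mean zero exactly when 0 ≤ δw + δ, that is w ≥ -1; hence the
    -- family of tangents starts at -1.
    have h1 := integral_gap_superlevel_nonneg hφ hN hab hC hCδ hδ0.le hδ1 (v := δ * w) (by
      rw [hm]
      exact mul_nonneg (by nlinarith [hw.1]) (by linarith))
    rw [← setIntegral_indicator (measurableSet_lt measurable_const hφ)] at h1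
    exact h1
  have hGc : Continuous fun s => tangentFun p δ (s / δ) (-1) := by
    unfold tangentFun; fun_prop
  have hfc : Continuous fun s : ℝ => δ ^ 2 * |s / δ| ^ p :=
    continuous_const.mul ((Real.continuous_rpow_const (by linarith)).comp (by fun_prop))
  have hGi := integrableOn_comp_of_bounded hφ hN hGc a b
  have hfi := integrableOn_comp_of_bounded hφ hN hfc a b
  have hle : ∫ x in Ioo a b, (tangentFun p δ (φ x / δ) (-1) + ∫ w in Ioc (-1) M, F x w) ≤
      ∫ x in Ioo a b, δ ^ 2 * |φ x / δ| ^ p := by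
    refine integral_mono (hGi.add hF'.integral_prod_left) hfi fun x => ?_
    have h := tangentFun_add_integral_le (s := φ x / δ) (M := M) hp hp2 hδ hδ0.le hδ1.le
      (by rw [hM]; gcongr; exact (abs_le.1 (hN x)).2)
    refine le_trans (le_of_eq ?_) h
    simp only [add_right_inj]
    congr 1
    ext w
    simp only [hFdef]
    congr 1
    by_cases hw : δ * w < φ x
    · have hw' : w < φ x / δ := by rw [lt_div_iff₀ hδ0]; linarith
      rw [indicator_of_mem (by exact hw), indicator_of_mem (by exact hw')]
      congr 1
      field_simp
    · have hw' : ¬ w < φ x / δ := by rw [lt_div_iff₀ hδ0]; linarith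
      rw [indicator_of_notMem (by exact hw), indicator_of_notMem (by exact hw')]
  have hJ : IntegrableOn (fun x => ∫ w in Ioc (-1) M, F x w) (Ioo a b) := hF'.integral_prod_left
  rw [integral_add hGi hJ] at hle
  linarith

/-- Lower bound for the `L^p`-oscillation in terms of the exponential integral. -/
theorem exists_integral_abs_rpow_ge {p δ C : ℝ} (hp : 1 < p) (hp2 : p ≤ 2) (hδ : 2 - p ≤ δ)
    (hδ0 : 0 < δ) (hδ1 : δ < 1) (hCδ : Real.exp (-δ) = C * (1 - δ)) :
    ∃ κ : ℝ, ∀ (φ : ℝ → ℝ) (N a b : ℝ), Measurable φ → (∀ x, |φ x| ≤ N) → a ≤ b →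
      ExpBound C φ a b → ∫ x in Ioo a b, φ x = 0 →
      (b - a) * (δ ^ p * logNormPow p) - κ * (C * (b - a) - ∫ x in Ioo a b, Real.exp (φ x)) ≤
        ∫ x in Ioo a b, |φ x| ^ p := by
  set A := (1 - δ) * (p * (p - 1)) * (Real.exp (-1) * gammaTail p (-1)) with hA
  refine ⟨δ ^ p / δ ^ 2 * (A * Real.exp δ), fun φ N a b hφ hN hab hC hm => ?_⟩
  have h := integral_tangentFun_le hp hp2 hδ hδ0 hδ1 hCδ hφ hN hab hC hm
  have hie := integrableOn_comp_of_bounded hφ hN Real.continuous_exp a b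
  have hi := integrableOn_Ioo_of_bounded hφ hN a b
  -- The tangent at -1 is affine in φ and e^φ, so its integral sees only ∫φ = 0 and ∫e^φ.
  have hpt : ∀ x, tangentFun p δ (φ x / δ) (-1) = A * Real.exp δ * Real.exp (φ x) +
      ((-p * δ - A) * φ x + (δ ^ 2 * (1 - p) - A * (1 + δ))) := by
    intro x
    have h1 : Real.exp (δ * (φ x / δ - -1)) = Real.exp δ * Real.exp (φ x) := by
      rw [← Real.exp_add]; congr 1; field_simp; ring
    rw [tangentFun, h1]
    simp only [abs_neg, abs_one, Real.one_rpow]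
    rw [← hA]
    field_simp
    ring
  have hpt2 : ∀ x, δ ^ 2 * |φ x / δ| ^ p = δ ^ 2 / δ ^ p * |φ x| ^ p := by
    intro x
    rw [abs_div, abs_of_pos hδ0, Real.div_rpow (abs_nonneg _) hδ0.le]
    ring
  simp_rw [hpt, hpt2] at h
  have hi2 : IntegrableOn (fun x => (-p * δ - A) * φ x + (δ ^ 2 * (1 - p) - A * (1 + δ))) (Ioo a b) :=
    (hi.const_mul _).add (by simp)
  rw [integral_add (hie.const_mul _) hi2, integral_add (hi.const_mul _) (by simp)] at h
  simp only [integral_const_mul, hm, mul_zero, zero_add, integral_const,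
    measureReal_restrict_apply_univ, Real.volume_real_Ioo_of_le hab, smul_eq_mul] at h
  have hδp : 0 < δ ^ p := Real.rpow_pos_of_pos hδ0 p
  -- This evaluates the affine bound when the exponential average is C: it becomes δ² · `logNormPow
  -- p`, the value for the logarithm. The κ-term measures the deficit from C.
  have hAC : A * Real.exp δ * C = A * (1 + δ) + δ ^ 2 * (p - 1 + logNormPow p) := by
    have e1 : Real.exp δ * C * (1 - δ) = 1 := by
      rw [mul_assoc, ← hCδ, ← Real.exp_add]; simp
    have e2 := gammaTail_neg_one hp
    have e3 : p * (p - 1) * (Real.exp (-1) * gammaTail p (-1)) = p - 1 + logNormPow p := by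
      rw [logNormPow, Real.exp_neg]
      have := Real.exp_pos 1
      field_simp
      linear_combination p * e2
    have e4 : A = (1 - δ) * (p - 1 + logNormPow p) := by rw [← e3, hA]; ring
    rw [e4]
    linear_combination (p - 1 + logNormPow p) * e1
  set I := ∫ x in Ioo a b, Real.exp (φ x)
  set Q := ∫ x in Ioo a b, |φ x| ^ p
  have h2 : δ ^ p / δ ^ 2 * (A * Real.exp δ * I + (b - a) * (δ ^ 2 * (1 - p) - A * (1 + δ))) ≤ Q := by
    calc _ ≤ δ ^ p / δ ^ 2 * (δ ^ 2 / δ ^ p * Q) := by gcongr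
      _ = Q := by field_simp
  refine le_trans (le_of_eq ?_) h2
  have h3 : δ ^ p * logNormPow p = δ ^ p / δ ^ 2 * (δ ^ 2 * logNormPow p) := by field_simp
  rw [h3]
  linear_combination -(δ ^ p / δ ^ 2 * (b - a)) * hAC

/-! ### The function `k` -/

/-- The convex function `x e^{1/x - 1}`, whose two inverse branches are `1/(1 - ξ^±)`. -/
noncomputable def mulExpInv (x : ℝ) : ℝ := x * Real.exp (1 / x - 1)

/-- The left side is the tangent line at y. Dividing by x reduces the claim to 1+u ≤ e^u with u =
1/x - 1/y, so convexity needs no second derivative. -/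
theorem tangent_le_mulExpInv {x y : ℝ} (hx : 0 < x) :
    Real.exp (1 / y - 1) * (x + 1 - x / y) ≤ mulExpInv x := by
  have h := Real.add_one_le_exp (1 / x - 1 / y)
  have h2 : Real.exp (1 / x - 1) = Real.exp (1 / y - 1) * Real.exp (1 / x - 1 / y) := by
    rw [← Real.exp_add]; ring_nf
  rw [mulExpInv, h2]
  calc Real.exp (1 / y - 1) * (x + 1 - x / y)
      = Real.exp (1 / y - 1) * (x * (1 / x - 1 / y + 1)) := by
        congr 1; rw [mul_add, mul_sub, mul_one_div_cancel hx.ne']; ring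
    _ ≤ Real.exp (1 / y - 1) * (x * Real.exp (1 / x - 1 / y)) := by gcongr
    _ = _ := by ring

theorem tangent_lt_mulExpInv {x y : ℝ} (hx : 0 < x) (hxy : x ≠ y) :
    Real.exp (1 / y - 1) * (x + 1 - x / y) < mulExpInv x := by
  have hne : 1 / x - 1 / y ≠ 0 := by
    rw [sub_ne_zero, Ne, one_div, one_div, inv_inj]; exact hxy
  have h := Real.add_one_lt_exp hne
  have h2 : Real.exp (1 / x - 1) = Real.exp (1 / y - 1) * Real.exp (1 / x - 1 / y) := by
    rw [← Real.exp_add]; ring_nf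
  rw [mulExpInv, h2]
  calc Real.exp (1 / y - 1) * (x + 1 - x / y)
      = Real.exp (1 / y - 1) * (x * (1 / x - 1 / y + 1)) := by
        congr 1; rw [mul_add, mul_sub, mul_one_div_cancel hx.ne']; ring
    _ < Real.exp (1 / y - 1) * (x * Real.exp (1 / x - 1 / y)) := by gcongr
    _ = _ := by ring

theorem mulExpInv_le_of_one_le {x y : ℝ} (hx : 1 ≤ x) (hxy : x ≤ y) :
    mulExpInv x ≤ mulExpInv y := by
  have hx0 : 0 < x := by linarith
  refine le_trans ?_ (tangent_le_mulExpInv (y := x) (hx0.trans_le hxy))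
  rw [mulExpInv, mul_comm]
  gcongr
  have : (y - x) / x ≤ y - x := div_le_self (by linarith) hx
  rw [sub_div, div_self hx0.ne'] at this
  linarith

theorem mulExpInv_le_of_le_one {x y : ℝ} (hx : 0 < x) (hxy : x ≤ y) (hy : y ≤ 1) :
    mulExpInv y ≤ mulExpInv x := by
  have hy0 : 0 < y := hx.trans_le hxy
  refine le_trans ?_ (tangent_le_mulExpInv (y := y) hx)
  rw [mulExpInv, mul_comm]
  gcongr
  have : y - x ≤ (y - x) / y := le_div_self (by linarith) hy0 hy
  rw [sub_div, div_self hy0.ne'] at this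
  linarith

theorem mulExpInv_combo_lt {x t : ℝ} (hx : 0 < x) (hx1 : x ≠ 1) (ht0 : 0 < t) (ht1 : t < 1) :
    mulExpInv (t * x + (1 - t)) < t * mulExpInv x + (1 - t) := by
  set y := t * x + (1 - t) with hy
  have hy0 : 0 < y := add_pos (mul_pos ht0 hx) (by linarith)
  have h1 : x ≠ y := by
    intro h
    have : (1 - t) * (x - 1) = 0 := by rw [hy] at h; linarith
    rcases mul_eq_zero.1 this with h | h
    · linarith
    · exact hx1 (by linarith)
  have h2 := tangent_lt_mulExpInv hx h1
  have h3 := tangent_le_mulExpInv (x := 1) (y := y) one_pos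
  have h4 : mulExpInv 1 = 1 := by simp [mulExpInv]
  rw [h4] at h3
  calc mulExpInv y = t * (Real.exp (1 / y - 1) * (x + 1 - x / y)) +
        (1 - t) * (Real.exp (1 / y - 1) * (1 + 1 - 1 / y)) := by
        rw [mulExpInv]
        have : y + 1 - y / y = t * (x + 1 - x / y) + (1 - t) * (1 + 1 - 1 / y) := by
          rw [hy]; ring
        rw [div_self hy0.ne'] at this
        linear_combination Real.exp (1 / y - 1) * this
    _ < t * mulExpInv x + (1 - t) := by nlinarith

/-- The upper branch `1/(1 - ξ⁺(C))`. -/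
noncomputable def upperBranch (C : ℝ) : ℝ := 1 / (1 - xiPlus C)

/-- The lower branch `1/(1 - ξ⁻(C))`. -/
noncomputable def lowerBranch (C : ℝ) : ℝ := 1 / (1 - xiMinus C)

theorem mulExpInv_one_div_one_sub {C ξ : ℝ} (hξ1 : ξ < 1) (hξ : Real.exp (-ξ) = C * (1 - ξ)) :
    mulExpInv (1 / (1 - ξ)) = C := by
  have h : 1 - ξ ≠ 0 := by linarith
  rw [mulExpInv, one_div_one_div, show 1 - ξ - 1 = -ξ by ring, hξ]
  field_simp

theorem upperBranch_spec {C : ℝ} (hC : 1 ≤ C) : 1 ≤ upperBranch C ∧ mulExpInv (upperBranch C) = C := by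
  obtain ⟨h0, h1, h2⟩ := xiPlus_spec hC
  refine ⟨?_, mulExpInv_one_div_one_sub h1 h2⟩
  rw [upperBranch, le_div_iff₀ (by linarith)]
  linarith

theorem lowerBranch_spec {C : ℝ} (hC : 1 ≤ C) :
    0 < lowerBranch C ∧ lowerBranch C ≤ 1 ∧ mulExpInv (lowerBranch C) = C := by
  obtain ⟨h0, h2⟩ := xiMinus_spec hC
  refine ⟨div_pos one_pos (by linarith), ?_, mulExpInv_one_div_one_sub (by linarith) h2⟩
  rw [lowerBranch, div_le_iff₀ (by linarith)]
  linarith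

theorem xiPlus_pos {C : ℝ} (hC : 1 < C) : 0 < xiPlus C := by
  obtain ⟨h0, -, h2⟩ := xiPlus_spec hC.le
  refine lt_of_le_of_ne h0 fun h => ?_
  rw [← h] at h2
  simp at h2
  linarith

theorem one_lt_upperBranch {C : ℝ} (hC : 1 < C) : 1 < upperBranch C := by
  have h := xiPlus_pos hC
  obtain ⟨-, h1, -⟩ := xiPlus_spec hC.le
  rw [upperBranch, lt_div_iff₀ (by linarith)]
  linarith

theorem lowerBranch_ne_one {C : ℝ} (hC : 1 < C) : lowerBranch C ≠ 1 := by
  intro h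
  have := (lowerBranch_spec hC.le).2.2
  rw [h] at this
  simp [mulExpInv] at this
  linarith

/-- The denominator is the width of the set where `mulExpInv` is at most C, which turns questions
about k into convexity. -/
theorem k_eq_div {C : ℝ} (hC : 1 < C) : k C = 2 * (C - 1) / (upperBranch C - lowerBranch C) := by
  obtain ⟨-, h1, -⟩ := xiPlus_spec hC.le
  have h0 := xiPlus_pos hC
  obtain ⟨h2, -⟩ := xiMinus_spec hC.le
  have e1 : 1 - xiPlus C ≠ 0 := by linarith
  have e2 : 1 - xiMinus C ≠ 0 := by linarith
  have e3 : xiPlus C - xiMinus C ≠ 0 := by linarith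
  have e4 : upperBranch C - lowerBranch C =
      (xiPlus C - xiMinus C) / ((1 - xiPlus C) * (1 - xiMinus C)) := by
    rw [upperBranch, lowerBranch]; field_simp; ring
  rw [k, if_neg hC.ne', e4]
  field_simp

theorem branch_sub_pos {C : ℝ} (hC : 1 < C) : 0 < upperBranch C - lowerBranch C := by
  linarith [one_lt_upperBranch hC, (lowerBranch_spec hC.le).2.1]

theorem branch_sub_le {C D : ℝ} (hC : 1 < C) (hCD : C < D) :
    upperBranch C - lowerBranch C ≤ upperBranch D - lowerBranch D := by
  obtain ⟨h1, h2⟩ := upperBranch_spec hC.le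
  obtain ⟨h3, h4⟩ := upperBranch_spec (hC.trans hCD).le
  obtain ⟨h5, h6, h7⟩ := lowerBranch_spec hC.le
  obtain ⟨h8, h9, h10⟩ := lowerBranch_spec (hC.trans hCD).le
  have hP : upperBranch C ≤ upperBranch D := by
    by_contra! h
    have := mulExpInv_le_of_one_le h3 h.le
    linarith
  have hQ : lowerBranch D ≤ lowerBranch C := by
    by_contra! h
    have := mulExpInv_le_of_le_one h5 h.le h9
    linarith
  linarith

theorem k_pos {C : ℝ} (hC : 1 < C) : 0 < k C := by
  rw [k_eq_div hC]
  exact div_pos (by linarith) (branch_sub_pos hC)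

/-- Join the two endpoints at height D to the bottom point (1,1) of the graph. By strict convexity
these chords lie inside the graph at height C, so width/(C-1) strictly decreases in C. -/
theorem k_lt_k {C D : ℝ} (hC : 1 < C) (hCD : C < D) : k C < k D := by
  have hD : 1 < D := hC.trans hCD
  obtain ⟨h1, h2⟩ := upperBranch_spec hC.le
  obtain ⟨h3, h4⟩ := upperBranch_spec hD.le
  obtain ⟨h5, h6, h7⟩ := lowerBranch_spec hC.le
  obtain ⟨h8, h9, h10⟩ := lowerBranch_spec hD.le
  set t := (C - 1) / (D - 1) with ht
  have ht0 : 0 < t := div_pos (by linarith) (by linarith)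
  have ht1 : t < 1 := (div_lt_one (by linarith)).2 (by linarith)
  have htD : t * D + (1 - t) = C := by
    have : D - 1 ≠ 0 := by linarith
    rw [ht]; field_simp; ring
  have hP : t * upperBranch D + (1 - t) < upperBranch C := by
    by_contra! h
    have e1 := mulExpInv_combo_lt (by linarith) (one_lt_upperBranch hD).ne' ht0 ht1
    have e2 := mulExpInv_le_of_one_le h1 h
    rw [h4, htD] at e1
    linarith
  have hQ : lowerBranch C < t * lowerBranch D + (1 - t) := by
    by_contra! h
    have e1 := mulExpInv_combo_lt h8 (lowerBranch_ne_one hD) ht0 ht1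
    have e2 := mulExpInv_le_of_le_one (add_pos (mul_pos ht0 h8) (by linarith)) h h6
    rw [h10, htD] at e1
    linarith
  rw [k_eq_div hC, k_eq_div hD, div_lt_div_iff₀ (branch_sub_pos hC) (branch_sub_pos hD)]
  have h11 : t * (upperBranch D - lowerBranch D) < upperBranch C - lowerBranch C := by linarith
  have h12 : C - 1 = t * (D - 1) := by
    have : D - 1 ≠ 0 := by linarith
    rw [ht]; field_simp
  calc 2 * (C - 1) * (upperBranch D - lowerBranch D)
      = 2 * (D - 1) * (t * (upperBranch D - lowerBranch D)) := by rw [h12]; ring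
    _ < 2 * (D - 1) * (upperBranch C - lowerBranch C) := by
      have : 0 < D - 1 := by linarith
      gcongr

/-- The width is nondecreasing in C, so k(C)/(C-1) is nonincreasing. This limits the growth of k and
serves in place of continuity. -/
theorem k_le_mul_k {C D : ℝ} (hC : 1 < C) (hCD : C < D) : k D * (C - 1) ≤ k C * (D - 1) := by
  have hD : 1 < D := hC.trans hCD
  rw [k_eq_div hC, k_eq_div hD]
  have h1 := branch_sub_pos hC
  have h2 := branch_sub_le hC hCD
  calc 2 * (D - 1) / (upperBranch D - lowerBranch D) * (C - 1)
      = 2 * (D - 1) * (C - 1) / (upperBranch D - lowerBranch D) := by ring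
    _ ≤ 2 * (D - 1) * (C - 1) / (upperBranch C - lowerBranch C) := by
        gcongr
    _ = _ := by ring

theorem k_one : k 1 = 0 := by simp [k]

theorem strictMonoOn_k : StrictMonoOn k (Ici 1) := by
  intro C hC D hD hCD
  rcases (mem_Ici.1 hC).eq_or_lt with rfl | h
  · rw [k_one]; exact k_pos hCD
  · exact k_lt_k h hCD

theorem upperBranch_le {C : ℝ} (hC : 1 ≤ C) : upperBranch C ≤ Real.exp 1 * C := by
  obtain ⟨h1, h2⟩ := upperBranch_spec hC
  have h0 : 0 < upperBranch C := by linarith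
  have h3 : Real.exp (-1) ≤ Real.exp (1 / upperBranch C - 1) :=
    Real.exp_le_exp.2 (by have := one_div_pos.2 h0; linarith)
  calc upperBranch C = Real.exp 1 * (upperBranch C * Real.exp (-1)) := by
        rw [mul_left_comm, ← Real.exp_add]; simp
    _ ≤ Real.exp 1 * (upperBranch C * Real.exp (1 / upperBranch C - 1)) := by gcongr
    _ = Real.exp 1 * C := by rw [← mulExpInv, h2]

theorem le_upperBranch {C : ℝ} (hC : 1 ≤ C) : Real.exp 1 * (C - 1) ≤ upperBranch C := by
  obtain ⟨h1, h2⟩ := upperBranch_spec hC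
  have h0 : 0 < upperBranch C := by linarith
  have h3 : Real.exp 1 * C = upperBranch C * Real.exp (1 / upperBranch C) := by
    conv_lhs => rw [← h2]
    rw [mulExpInv, mul_left_comm, ← Real.exp_add]; ring_nf
  set u := 1 / upperBranch C with hu
  have hu1 : u ≤ 1 := (div_le_one h0).2 h1
  have h4 : upperBranch C * u = 1 := by rw [hu]; field_simp
  have h5 : (1 - u) * Real.exp u ≤ 1 := by
    have := Real.add_one_le_exp (-u)
    have h3 : Real.exp (-u) * Real.exp u = 1 := by rw [← Real.exp_add]; simp
    nlinarith [Real.exp_pos u]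
  have h6 : Real.exp u ≤ Real.exp 1 := Real.exp_le_exp.2 hu1
  have h7 : upperBranch C * Real.exp u - Real.exp u ≤ upperBranch C := by
    calc upperBranch C * Real.exp u - Real.exp u = upperBranch C * ((1 - u) * Real.exp u) := by
          linear_combination Real.exp u * h4
      _ ≤ upperBranch C * 1 := by gcongr
      _ = upperBranch C := mul_one _
  linarith

theorem k_lt_two_div_exp {C : ℝ} (hC : 1 ≤ C) : k C < 2 / Real.exp 1 := by
  have he := Real.exp_pos 1
  have hle : ∀ C, 1 < C → k C ≤ 2 / Real.exp 1 := by
    intro C hC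
    by_contra! h
    set η := k C - 2 / Real.exp 1 with hη
    have hη0 : 0 < η := by linarith
    -- If k(C) = 2/e + η, monotonicity keeps k above this value, while at x+1 the width is at least
    -- ex - 1; this x is large enough for a contradiction. Strictness follows afterwards by
    -- comparison with C+1.
    set x := max C (2 / Real.exp 1 / (η * Real.exp 1) + 2 / Real.exp 1) with hx
    have hxC : C ≤ x := le_max_left _ _
    have hx2 : 2 / Real.exp 1 / (η * Real.exp 1) + 2 / Real.exp 1 ≤ x := le_max_right _ _
    have hD : C < x + 1 := by linarith
    have h1 := k_lt_k hC hD
    have hD1 : 1 < x + 1 := hC.trans hD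
    have h2 := le_upperBranch hD1.le
    have h3 := (lowerBranch_spec hD1.le).2.1
    have h4 := branch_sub_pos hD1
    rw [k_eq_div hD1, lt_div_iff₀ h4] at h1
    have hk : k C = 2 / Real.exp 1 + η := by rw [hη]; ring
    have h5 : k C * (Real.exp 1 * x - 1) ≤ k C * (upperBranch (x + 1) - lowerBranch (x + 1)) := by
      refine mul_le_mul_of_nonneg_left ?_ (k_pos hC).le
      rw [add_sub_cancel_right] at h2
      linarith
    have h6 : k C * (Real.exp 1 * x - 1) = 2 * x + η * Real.exp 1 * x - 2 / Real.exp 1 - η := by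
      rw [hk]; field_simp; ring
    have h7 : 2 / Real.exp 1 + 2 * η ≤ η * Real.exp 1 * x := by
      calc 2 / Real.exp 1 + 2 * η
          = η * Real.exp 1 * (2 / Real.exp 1 / (η * Real.exp 1) + 2 / Real.exp 1) := by field_simp
        _ ≤ _ := by gcongr
    linarith
  exact (strictMonoOn_k hC (show C + 1 ∈ Ici 1 by simp only [mem_Ici]; linarith) (by linarith)).trans_le
    (hle (C + 1) (by linarith))

theorem xiPlus_eq {δ : ℝ} (h0 : 0 ≤ δ) (h1 : δ < 1) : xiPlus (Real.exp (-δ) / (1 - δ)) = δ := by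
  have hC : 1 ≤ Real.exp (-δ) / (1 - δ) := by
    rw [le_div_iff₀ (by linarith)]
    linarith [Real.add_one_le_exp (-δ)]
  refine (existsUnique_xiPlus hC).unique (xiPlus_spec hC) ⟨h0, h1, ?_⟩
  rw [div_mul_cancel₀]
  linarith

theorem exists_k_lt {ε : ℝ} (hε : 0 < ε) : ∃ C, 1 < C ∧ k C < ε := by
  set a := min (ε / 4) (1 / 2) with ha
  have ha0 : 0 < a := lt_min (by linarith) (by norm_num)
  have ha1 : a ≤ 1 / 2 := min_le_right _ _
  have haε : a ≤ ε / 4 := min_le_left _ _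
  have hC : 1 < Real.exp (-a) / (1 - a) := by
    rw [lt_div_iff₀ (by linarith)]
    linarith [Real.add_one_lt_exp (x := -a) (by linarith)]
  -- For ξ⁺ = a small, C - 1 is at most a²/(1-a) while the width is at least a/(1-a), so k ≤ 2a ≤
  -- ε/2.
  refine ⟨_, hC, ?_⟩
  have hP : upperBranch (Real.exp (-a) / (1 - a)) = 1 / (1 - a) := by
    rw [upperBranch, xiPlus_eq ha0.le (by linarith)]
  have hQ := (lowerBranch_spec hC.le).2.1
  rw [k_eq_div hC, div_lt_iff₀ (branch_sub_pos hC), hP]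
  have h1 : Real.exp (-a) ≤ 1 - a + a ^ 2 := by
    have := Real.abs_exp_sub_one_sub_id_le (x := -a) (by rw [abs_neg, abs_of_pos ha0]; linarith)
    have := (abs_le.1 this).2
    nlinarith
  have h2 : 0 < 1 - a := by linarith
  have h3 : ε * (a / (1 - a)) ≤ ε * (1 / (1 - a) - lowerBranch (Real.exp (-a) / (1 - a))) := by
    refine mul_le_mul_of_nonneg_left ?_ hε.le
    have : a / (1 - a) = 1 / (1 - a) - 1 := by field_simp; ring
    linarith
  refine lt_of_lt_of_le ?_ h3
  have h4 : 2 * (Real.exp (-a) / (1 - a) - 1) = 2 * (Real.exp (-a) - 1 + a) / (1 - a) := by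
    field_simp; ring
  rw [h4, ← mul_div_assoc]
  refine div_lt_div_of_pos_right ?_ h2
  nlinarith

theorem exists_lt_k {ε : ℝ} (hε0 : 0 ≤ ε) (hε : ε < 2 / Real.exp 1) : ∃ C, 1 < C ∧ ε < k C := by
  have he := Real.exp_pos 1
  have h1 : 0 < 2 / Real.exp 1 - ε := by linarith
  -- Since k(C) > 2(C-1)/(eC) = 2/e - 2/(eC), any C ≥ (2/e)/(2/e - ε) would do; twice this threshold
  -- also ensures C > 1.
  set C := 4 / Real.exp 1 / (2 / Real.exp 1 - ε) with hC
  have h2 : 2 ≤ C := by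
    rw [hC, le_div_iff₀ h1]
    have : 4 / Real.exp 1 = 2 * (2 / Real.exp 1) := by ring
    nlinarith
  have hC1 : 1 < C := by linarith
  refine ⟨C, hC1, ?_⟩
  have h3 := upperBranch_le hC1.le
  have h4 := (lowerBranch_spec hC1.le).1
  have h5 := branch_sub_pos hC1
  rw [k_eq_div hC1, lt_div_iff₀ h5]
  have h6 : C * (2 / Real.exp 1 - ε) = 4 / Real.exp 1 := div_mul_cancel₀ _ h1.ne'
  have h7 : C * (2 - ε * Real.exp 1) = 4 := by
    have : C * (2 - ε * Real.exp 1) = C * (2 / Real.exp 1 - ε) * Real.exp 1 := by field_simp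
    rw [this, h6]; field_simp
  nlinarith

theorem surjOn_k : SurjOn k (Ici 1) (Ico 0 (2 / Real.exp 1)) := by
  rintro ε ⟨hε0, hε⟩
  rcases hε0.eq_or_lt with rfl | hε0
  · exact ⟨1, self_mem_Ici, k_one⟩
  obtain ⟨C₀, hC₀, hk₀⟩ := exists_k_lt hε0
  obtain ⟨C₁, hC₁, hk₁⟩ := exists_lt_k hε0.le hε
  set A : Set ℝ := {C | 1 < C ∧ k C ≤ ε} with hA
  have hbdd : BddAbove A := by
    refine ⟨C₁, fun C hC => ?_⟩
    by_contra! h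
    have := k_lt_k hC₁ h
    linarith [hC.2]
  have hmem : C₀ ∈ A := ⟨hC₀, hk₀.le⟩
  set s := sSup A with hs
  have hs1 : 1 < s := hC₀.trans_le (le_csSup hbdd hmem)
  have hks := k_pos hs1
  refine ⟨s, hs1.le, ?_⟩
  -- Multiplying s-1 by r multiplies k by at most r when r > 1 and by at least r when r < 1. This r
  -- sends k(s) to the midpoint of k(s) and ε, so a jump at the supremum s is impossible in either
  -- direction.
  set r := (ε + k s) / (2 * k s) with hr
  have hr1 : k s * r = (ε + k s) / 2 := by rw [hr]; field_simp
  have hr0 : 0 < r := by positivity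
  rcases lt_trichotomy (k s) ε with h | h | h
  · exfalso
    have hr2 : 1 < r := by rw [hr, one_lt_div (by linarith)]; linarith
    have hlt : s < 1 + (s - 1) * r := by nlinarith
    have h1 := k_le_mul_k hs1 hlt
    have h2 : k (1 + (s - 1) * r) ≤ k s * r := by
      refine le_of_mul_le_mul_right (a := s - 1) ?_ (by linarith)
      linarith
    exact absurd (le_csSup hbdd (show 1 + (s - 1) * r ∈ A from ⟨by linarith, by linarith⟩))
      (not_le.2 hlt)
  · exact h
  · exfalso
    have hr2 : r < 1 := by rw [hr, div_lt_one (by linarith)]; linarith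
    have hlt : 1 + (s - 1) * r < s := by nlinarith
    have hgt : 1 < 1 + (s - 1) * r := by nlinarith
    obtain ⟨D, hD, hDs⟩ := exists_lt_of_lt_csSup ⟨C₀, hmem⟩ hlt
    have h1 := k_le_mul_k hgt hlt
    have h2 : k s * r ≤ k (1 + (s - 1) * r) := by
      refine le_of_mul_le_mul_right (a := s - 1) ?_ (by linarith)
      linarith
    have h3 := k_lt_k hgt hDs
    linarith [hD.2]

theorem bijOn_k : BijOn k (Ici 1) (Ico 0 (2 / Real.exp 1)) := by
  refine ⟨fun C hC => ⟨?_, k_lt_two_div_exp hC⟩, strictMonoOn_k.injOn, surjOn_k⟩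
  rcases (mem_Ici.1 hC).eq_or_lt with rfl | h
  · exact k_one.ge
  · exact (k_pos h).le

theorem kInv_spec {ε : ℝ} (h0 : 0 ≤ ε) (h1 : ε < 2 / Real.exp 1) : 1 ≤ kInv ε ∧ k (kInv ε) = ε :=
  have h : ∃ C ∈ Ici 1, k C = ε := surjOn_k ⟨h0, h1⟩
  ⟨Function.invFunOn_mem h, Function.invFunOn_eq h⟩

/-! ### Bounded functions with small oscillation -/

/-- All `p`-oscillations of `φ` over subintervals of `(0,1)` are at most `ε`, in terms of
integrals. -/
def OscBound (p ε : ℝ) (φ : ℝ → ℝ) : Prop :=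
  ∀ a b, 0 ≤ a → a < b → b ≤ 1 →
    ∫ x in Ioo a b, |φ x - (∫ y in Ioo a b, φ y) / (b - a)| ^ p ≤ ε ^ p * (b - a)

theorem setAverage_Ioo_eq_div {a b : ℝ} (hab : a < b) (f : ℝ → ℝ) :
    ⨍ x in Ioo a b, f x = (∫ x in Ioo a b, f x) / (b - a) := by
  rw [setAverage_eq, Real.volume_real_Ioo_of_le hab.le, smul_eq_mul]
  ring

theorem oscBound_of_osc_le {p ε N : ℝ} (hp : 1 ≤ p) (hε : 0 ≤ ε) {φ : ℝ → ℝ} (hφ : Measurable φ)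
    (hN : ∀ x, |φ x| ≤ N)
    (h : ∀ a b, 0 ≤ a → a < b → b ≤ 1 → osc p φ a b ≤ ENNReal.ofReal ε) : OscBound p ε φ := by
  intro a b ha hab hb
  have h1 := h a b ha hab hb
  have hp0 : 0 < p := by linarith
  have hc : Continuous fun s => |s - ⨍ y in Ioo a b, φ y| ^ p :=
    (Real.continuous_rpow_const hp0.le).comp (by fun_prop)
  have hi := integrableOn_comp_of_bounded hφ hN hc a b
  rw [osc, one_div, ENNReal.rpow_inv_le_iff hp0, ENNReal.ofReal_rpow_of_nonneg hε hp0.le,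
    setLAverage_eq, ← ofReal_setAverage hi (ae_of_all _ fun x => by positivity),
    ENNReal.ofReal_le_ofReal_iff (by positivity), setAverage_Ioo_eq_div hab,
    setAverage_Ioo_eq_div hab, div_le_iff₀ (sub_pos.2 hab)] at h1
  exact h1

theorem ExpBound.mono {C : ℝ} {φ : ℝ → ℝ} {a b c d : ℝ} (h : ExpBound C φ a b) (hc : a ≤ c)
    (hd : d ≤ b) : ExpBound C φ c d := fun x y hx hxy hy => h x y (hc.trans hx) hxy (hy.trans hd)

theorem integral_sub_const_Ioo {φ : ℝ → ℝ} {c d : ℝ} (hcd : c ≤ d) (hi : IntegrableOn φ (Ioo c d))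
    (m : ℝ) : ∫ x in Ioo c d, (φ x - m) = (∫ x in Ioo c d, φ x) - m * (d - c) := by
  rw [integral_sub hi (by simp)]
  simp [Real.volume_real_Ioo_of_le hcd, mul_comm]

theorem integral_exp_sub_const (φ : ℝ → ℝ) (s : Set ℝ) (m : ℝ) :
    ∫ x in s, Real.exp (φ x - m) = Real.exp (-m) * ∫ x in s, Real.exp (φ x) := by
  rw [← integral_const_mul]
  congr 1
  ext x
  rw [← Real.exp_add]; ring_nf

theorem ExpBound.sub_const {C N : ℝ} {φ : ℝ → ℝ} (hφ : Measurable φ) (hN : ∀ x, |φ x| ≤ N)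
    {a b : ℝ} (h : ExpBound C φ a b) (m : ℝ) : ExpBound C (fun x => φ x - m) a b := by
  intro c d hc hcd hd
  have hdc : 0 < d - c := sub_pos.2 hcd
  rw [integral_exp_sub_const, integral_sub_const_Ioo hcd.le (integrableOn_Ioo_of_bounded hφ hN c d),
    sub_div, mul_div_cancel_right₀ _ hdc.ne', sub_eq_neg_add _ m, Real.exp_add]
  calc _ ≤ Real.exp (-m) * _ := mul_le_mul_of_nonneg_left (h c d hc hcd hd) (Real.exp_pos _).le
    _ = _ := by ring

/-- A bounded function satisfies the exponential condition with a sharp constant. -/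
theorem exists_sharp_expBound {φ : ℝ → ℝ} (hφ : Measurable φ) {N : ℝ} (hN : ∀ x, |φ x| ≤ N) :
    ∃ C, 1 ≤ C ∧ ExpBound C φ 0 1 ∧ ∀ η, 0 < η → ∃ a b, 0 ≤ a ∧ a < b ∧ b ≤ 1 ∧
      (C - η) * (b - a) ≤
        ∫ x in Ioo a b, Real.exp (φ x - (∫ y in Ioo a b, φ y) / (b - a)) := by
  set J : ℝ × ℝ → ℝ := fun I =>
    (∫ x in Ioo I.1 I.2, Real.exp (φ x - (∫ y in Ioo I.1 I.2, φ y) / (I.2 - I.1))) / (I.2 - I.1)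
    with hJ
  set D : Set (ℝ × ℝ) := {I | 0 ≤ I.1 ∧ I.1 < I.2 ∧ I.2 ≤ 1} with hD
  have hmean : ∀ I ∈ D, |(∫ y in Ioo I.1 I.2, φ y) / (I.2 - I.1)| ≤ N := by
    rintro ⟨a, b⟩ ⟨-, hab, -⟩
    have hba : 0 < b - a := sub_pos.2 hab
    rw [abs_div, abs_of_pos hba, div_le_iff₀ hba]
    have := norm_setIntegral_le_of_norm_le_const (μ := volume) (s := Ioo a b) (f := φ) (C := N)
      (by simp) (fun x _ => hN x)
    rwa [Real.volume_real_Ioo_of_le hab.le] at this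
  have hi : ∀ a b m, IntegrableOn (fun x => Real.exp (φ x - m)) (Ioo a b) := fun a b m =>
    integrableOn_comp_of_bounded hφ hN (g := fun s => Real.exp (s - m)) (by fun_prop) a b
  -- Boundedness of φ makes the supremum finite a priori, which is why truncation precedes
  -- everything else.
  have hbdd : BddAbove (J '' D) := by
    refine ⟨Real.exp (2 * N), ?_⟩
    rintro _ ⟨⟨a, b⟩, hI, rfl⟩
    have hab : a < b := hI.2.1
    have hba : 0 < b - a := sub_pos.2 hab
    have hm := hmean _ hI
    simp only [hJ]
    rw [div_le_iff₀ hba]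
    have h1 : ∫ x in Ioo a b, Real.exp (φ x - (∫ y in Ioo a b, φ y) / (b - a)) ≤
        ∫ x in Ioo a b, Real.exp (2 * N) := by
      refine integral_mono (hi _ _ _) (by simp) fun x => Real.exp_le_exp.2 ?_
      have := (abs_le.1 (hN x)).2
      have := (abs_le.1 hm).1
      simp only at this
      linarith
    refine h1.trans (le_of_eq ?_)
    simp [Real.volume_real_Ioo_of_le hab.le, mul_comm]
  have hone : ∀ I ∈ D, 1 ≤ J I := by
    rintro ⟨a, b⟩ ⟨-, hab, -⟩
    simp only at hab
    have hba : 0 < b - a := sub_pos.2 hab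
    simp only [hJ]
    rw [le_div_iff₀ hba, one_mul]
    set m := (∫ y in Ioo a b, φ y) / (b - a) with hm
    have hiφ := integrableOn_Ioo_of_bounded hφ hN a b
    have h1 : ∫ x in Ioo a b, (φ x - (m - 1)) ≤ ∫ x in Ioo a b, Real.exp (φ x - m) := by
      refine integral_mono (hiφ.sub (by simp)) (hi _ _ _) fun x => ?_
      have := Real.add_one_le_exp (φ x - m)
      simp only
      linarith
    rw [integral_sub_const_Ioo hab.le hiφ] at h1
    have h2 : m * (b - a) = ∫ y in Ioo a b, φ y := by rw [hm]; field_simp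
    linarith
  have hD01 : ((0 : ℝ), (1 : ℝ)) ∈ D := ⟨le_rfl, one_pos, le_rfl⟩
  refine ⟨sSup (J '' D), (hone _ hD01).trans (le_csSup hbdd ⟨_, hD01, rfl⟩), ?_, ?_⟩
  · intro c d hc hcd hd
    have hdc : 0 < d - c := sub_pos.2 hcd
    have h1 := le_csSup hbdd ⟨(c, d), ⟨hc, hcd, hd⟩, rfl⟩
    simp only [hJ] at h1
    rw [div_le_iff₀ hdc, integral_exp_sub_const] at h1
    set m := (∫ y in Ioo c d, φ y) / (d - c)
    calc ∫ x in Ioo c d, Real.exp (φ x)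
        = Real.exp m * (Real.exp (-m) * ∫ x in Ioo c d, Real.exp (φ x)) := by
          rw [← mul_assoc, ← Real.exp_add]; simp
      _ ≤ Real.exp m * (sSup (J '' D) * (d - c)) := by gcongr
      _ = _ := by ring
  · intro η hη
    obtain ⟨_, ⟨⟨a, b⟩, ⟨ha, hab, hb⟩, rfl⟩, hlt⟩ :=
      exists_lt_of_lt_csSup (Set.Nonempty.image J ⟨_, hD01⟩) (sub_lt_self (sSup (J '' D)) hη)
    simp only at ha hab hb
    refine ⟨a, b, ha, hab, hb, ?_⟩
    rw [← le_div_iff₀ (sub_pos.2 hab)]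
    exact hlt.le

/-- On a nearly optimal interval the deficit from C is a small multiple of its length, so after
division by the length the κ-term disappears in the limit. No optimal interval need exist. -/
theorem xiPlus_rpow_le {p ε C N : ℝ} (hp : 1 < p) (hp2 : p ≤ 2) {φ : ℝ → ℝ} (hφ : Measurable φ)
    (hN : ∀ x, |φ x| ≤ N) (hε : OscBound p ε φ) (hC1 : 1 < C) (hC : ExpBound C φ 0 1)
    (hsharp : ∀ η, 0 < η → ∃ a b, 0 ≤ a ∧ a < b ∧ b ≤ 1 ∧ (C - η) * (b - a) ≤
        ∫ x in Ioo a b, Real.exp (φ x - (∫ y in Ioo a b, φ y) / (b - a)))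
    (hδ : 2 - p ≤ xiPlus C) : xiPlus C ^ p * logNormPow p ≤ ε ^ p := by
  obtain ⟨-, h1, h2⟩ := xiPlus_spec hC1.le
  obtain ⟨κ, hκ⟩ := exists_integral_abs_rpow_ge hp hp2 hδ (xiPlus_pos hC1) h1 h2
  refine le_of_forall_pos_le_add fun θ hθ => ?_
  obtain ⟨a, b, ha, hab, hb, hη⟩ := hsharp (θ / (|κ| + 1)) (by positivity)
  have hba : 0 < b - a := sub_pos.2 hab
  set m := (∫ y in Ioo a b, φ y) / (b - a) with hm
  have hC' := (hC.sub_const hφ hN m).mono ha hb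
  have h0 : ∫ x in Ioo a b, (φ x - m) = 0 := by
    rw [integral_sub_const_Ioo hab.le (integrableOn_Ioo_of_bounded hφ hN a b), hm]
    field_simp
    ring
  have h3 := hκ (fun x => φ x - m) (N + |m|) a b (hφ.sub_const m)
    (fun x => (abs_sub _ _).trans (by linarith [hN x])) hab.le hC' h0
  have h4 := hε a b ha hab hb
  have h5 := hC' a b le_rfl hab le_rfl
  simp only [h0, zero_div, Real.exp_zero, mul_one] at h5
  set I := ∫ x in Ioo a b, Real.exp (φ x - m)
  have h6 : κ * (C * (b - a) - I) ≤ θ * (b - a) := by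
    calc κ * (C * (b - a) - I) ≤ |κ| * (C * (b - a) - I) :=
          mul_le_mul_of_nonneg_right (le_abs_self κ) (by linarith)
      _ ≤ (|κ| + 1) * (θ / (|κ| + 1) * (b - a)) := by
          refine mul_le_mul (by linarith) (by linarith) (by linarith) (by positivity)
      _ = θ * (b - a) := by field_simp
  refine le_of_mul_le_mul_right (a := b - a) ?_ hba
  linarith

theorem k_le_of_oscBound {ε C N : ℝ} {φ : ℝ → ℝ} (hφ : Measurable φ)
    (hN : ∀ x, |φ x| ≤ N) (hε : OscBound 1 ε φ) (hC1 : 1 < C) (hC : ExpBound C φ 0 1)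
    (hsharp : ∀ η, 0 < η → ∃ a b, 0 ≤ a ∧ a < b ∧ b ≤ 1 ∧ (C - η) * (b - a) ≤
        ∫ x in Ioo a b, Real.exp (φ x - (∫ y in Ioo a b, φ y) / (b - a))) : k C ≤ ε := by
  obtain ⟨h0, h1, h2⟩ := xiPlus_spec hC1.le
  obtain ⟨h3, h4⟩ := xiMinus_spec hC1.le
  have hB := branch_sub_pos hC1
  rw [k_eq_div hC1, div_le_iff₀ hB]
  refine le_of_forall_pos_le_add fun θ hθ => ?_
  obtain ⟨a, b, ha, hab, hb, hη⟩ := hsharp (θ / 2) (by positivity)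
  have hba : 0 < b - a := sub_pos.2 hab
  set m := (∫ y in Ioo a b, φ y) / (b - a) with hm
  have hz : ∫ x in Ioo a b, (φ x - m) = 0 := by
    rw [integral_sub_const_Ioo hab.le (integrableOn_Ioo_of_bounded hφ hN a b), hm]
    field_simp
    ring
  have h5 := integral_abs_ge_of_expBound (φ := fun x => φ x - m) (N := N + |m|) (hφ.sub_const m)
    (fun x => (abs_sub _ _).trans (by linarith [hN x])) hab.le
    ((hC.sub_const hφ hN m).mono ha hb) h2 h0 h1 h4 h3 hz
  have h6 := hε a b ha hab hb
  simp only [Real.rpow_one] at h6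
  change _ ≤ (upperBranch C - lowerBranch C) * _ at h5
  have h7 := mul_le_mul_of_nonneg_left h6 hB.le
  refine le_of_mul_le_mul_right (a := b - a) ?_ hba
  nlinarith

/-! ### Passage to unbounded functions -/

theorem exists_bounded_approx {p ε : ℝ} (hp : 1 ≤ p) (hε : 0 ≤ ε) {φ : ℝ → ℝ} (hφ : MemBMO p φ)
    (hn : bmoNorm p φ ≤ ENNReal.ofReal ε) (N : ℕ) :
    ∃ ψ : ℝ → ℝ, Measurable ψ ∧ (∀ x, |ψ x| ≤ N) ∧ OscBound p ε ψ ∧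
      ∀ᵐ x ∂volume.restrict (Ioo 0 1), ψ x = trunc N (φ x) := by
  -- A measurable representative is truncated, because the level-set arguments use genuine
  -- measurability and a bound at every point.
  have hm := hφ.integrableOn.aestronglyMeasurable
  set g := hm.mk φ with hg
  have hgm : Measurable g := hm.stronglyMeasurable_mk.measurable
  have hae : φ =ᵐ[volume.restrict (Ioo 0 1)] g := hm.ae_eq_mk
  have hN0 : (0 : ℝ) ≤ N := N.cast_nonneg
  have hψm : Measurable fun x => trunc N (g x) := (continuous_trunc N).measurable.comp hgm
  have hψN : ∀ x, |trunc N (g x)| ≤ N := fun x => abs_trunc_le hN0 _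
  refine ⟨_, hψm, hψN, oscBound_of_osc_le hp hε hψm hψN fun a b ha hab hb => ?_, ?_⟩
  · have hsub : Ioo a b ⊆ Ioo 0 1 := Ioo_subset_Ioo ha hb
    have hae' : ∀ᵐ x ∂volume.restrict (Ioo a b), φ x = g x :=
      ae_restrict_of_ae_restrict_of_subset hsub hae
    have heq : osc p (fun x => trunc N (g x)) a b = osc p (fun x => trunc N (φ x)) a b := by
      have h1 : ⨍ s in Ioo a b, trunc N (g s) = ⨍ s in Ioo a b, trunc N (φ s) :=
        average_congr (by filter_upwards [hae'] with x hx; rw [hx])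
      unfold osc
      rw [h1]
      congr 1
      exact laverage_congr (by filter_upwards [hae'] with x hx; rw [hx])
    rw [heq]
    refine (osc_trunc_le hp hN0 hab (hφ.integrableOn.mono_set hsub)).trans (le_trans ?_ hn)
    exact le_iSup₂_of_le a b (le_iSup₂_of_le ha hab (le_iSup_of_le hb le_rfl))
  · filter_upwards [hae] with x hx
    rw [hx]

/-- Truncations converge pointwise almost everywhere: dominated convergence handles the means, Fatou
the exponential averages. -/
theorem isJNBound_of_forall_bounded {p ε K : ℝ} (hp : 1 ≤ p) (hε : 0 ≤ ε) (hK : 0 ≤ K)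
    (h : ∀ (ψ : ℝ → ℝ) (N : ℝ), Measurable ψ → (∀ x, |ψ x| ≤ N) → OscBound p ε ψ →
      ExpBound K ψ 0 1) : IsJNBound p ε (ENNReal.ofReal K) := by
  intro φ hφ hn a b ha hab hb
  choose ψ hψm hψN hψo hψe using exists_bounded_approx hp hε hφ hn
  have hsub : Ioo a b ⊆ Ioo 0 1 := Ioo_subset_Ioo ha hb
  have hba : 0 < b - a := sub_pos.2 hab
  have hφi := hφ.integrableOn.mono_set hsub
  have hψe' : ∀ᵐ x ∂volume.restrict (Ioo a b), ∀ N : ℕ, ψ N x = trunc N (φ x) :=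
    ae_all_iff.2 fun N => ae_restrict_of_ae_restrict_of_subset hsub (hψe N)
  have hlim : ∀ᵐ x ∂volume.restrict (Ioo a b), ∀ᶠ N : ℕ in atTop, ψ N x = φ x := by
    filter_upwards [hψe'] with x hx
    obtain ⟨n, hn⟩ := exists_nat_ge |φ x|
    filter_upwards [eventually_ge_atTop n] with N hN
    rw [hx, trunc_eq_self (hn.trans (Nat.cast_le.2 hN))]
  have hmean : Tendsto (fun N => ⨍ x in Ioo a b, ψ N x) atTop (𝓝 (⨍ x in Ioo a b, φ x)) := by
    simp_rw [setAverage_Ioo_eq_div hab]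
    refine Tendsto.div_const ?_ _
    refine tendsto_integral_of_dominated_convergence (fun x => |φ x|)
      (fun N => (hψm N).aestronglyMeasurable) hφi.abs (fun N => ?_) ?_
    · filter_upwards [hψe'] with x hx
      rw [hx, Real.norm_eq_abs]
      exact abs_trunc_le_abs N.cast_nonneg _
    · filter_upwards [hlim] with x hx
      exact tendsto_const_nhds.congr' (hx.mono fun _ h => h.symm)
  have hbound : ∀ N, (⨍⁻ x in Ioo a b, ENNReal.ofReal (Real.exp (ψ N x)) ∂volume) ≤
      ENNReal.ofReal K * ENNReal.ofReal (Real.exp (⨍ x in Ioo a b, ψ N x)) := by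
    intro N
    rw [setLAverage_eq, ← ofReal_setAverage (integrableOn_comp_of_bounded (hψm N) (hψN N) Real.continuous_exp a b)
      (ae_of_all _ fun _ => (Real.exp_pos _).le), ← ENNReal.ofReal_mul hK, setAverage_Ioo_eq_div hab,
      setAverage_Ioo_eq_div hab]
    refine ENNReal.ofReal_le_ofReal ?_
    rw [div_le_iff₀ hba]
    exact (h (ψ N) N (hψm N) (hψN N) (hψo N) a b ha hab hb).trans (le_of_eq (by ring))
  have hlim2 : Tendsto (fun N => ENNReal.ofReal K * ENNReal.ofReal (Real.exp (⨍ x in Ioo a b, ψ N x)))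
      atTop (𝓝 (ENNReal.ofReal K * ENNReal.ofReal (Real.exp (⨍ x in Ioo a b, φ x)))) :=
    ENNReal.Tendsto.const_mul (ENNReal.tendsto_ofReal ((Real.continuous_exp.tendsto _).comp hmean))
      (Or.inr ENNReal.ofReal_ne_top)
  calc (⨍⁻ x in Ioo a b, ENNReal.ofReal (Real.exp (φ x)) ∂volume)
      = ⨍⁻ x in Ioo a b, liminf (fun N => ENNReal.ofReal (Real.exp (ψ N x))) atTop ∂volume := by
        refine laverage_congr ?_
        filter_upwards [hlim] with x hx
        exact (tendsto_const_nhds.congr' (hx.mono fun N h => by rw [h])).liminf_eq.symm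
    _ ≤ liminf (fun N => ⨍⁻ x in Ioo a b, ENNReal.ofReal (Real.exp (ψ N x)) ∂volume) atTop :=
        lintegral_liminf_le fun N => (Real.measurable_exp.comp (hψm N)).ennreal_ofReal
    _ ≤ liminf (fun N => ENNReal.ofReal K * ENNReal.ofReal (Real.exp (⨍ x in Ioo a b, ψ N x))) atTop :=
        liminf_le_liminf (Eventually.of_forall hbound)
    _ = _ := hlim2.liminf_eq

/-! ### Admissible constants -/

theorem exp_neg_div_le {δ ξ : ℝ} (h0 : 0 ≤ δ) (h : δ ≤ ξ) (h1 : ξ < 1) :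
    Real.exp (-δ) / (1 - δ) ≤ Real.exp (-ξ) / (1 - ξ) := by
  rw [div_le_div_iff₀ (by linarith) (by linarith)]
  have e1 : Real.exp (-δ) = Real.exp (-ξ) * Real.exp (ξ - δ) := by
    rw [← Real.exp_add]; ring_nf
  have h2 := gap_nonneg_of_mem_Icc (ξ := ξ) (r := ξ - δ) h1 (by linarith) (by linarith)
  rw [gap] at h2
  rw [e1, mul_assoc]
  gcongr
  linarith

/-- If the optimal C of a bounded function exceeded e^{-δ}/(1-δ), then ξ⁺(C) > δ ≥ 2-p, and the
oscillation bound would force ξ⁺(C) ≤ δ. -/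
theorem isJNBound_of_one_lt {p δ : ℝ} (hp : 1 < p) (hp2 : p ≤ 2) (hδ : 2 - p ≤ δ) (hδ1 : δ < 1) :
    IsJNBound p (δ * logNormPow p ^ (1 / p)) (ENNReal.ofReal (Real.exp (-δ) / (1 - δ))) := by
  have hδ0 : 0 ≤ δ := by linarith
  have hp0 : 0 < p := by linarith
  have hA := logNormPow_pos hp0
  have hK : 1 ≤ Real.exp (-δ) / (1 - δ) := by
    rw [le_div_iff₀ (by linarith)]
    linarith [Real.add_one_le_exp (-δ)]
  refine isJNBound_of_forall_bounded hp.le (by positivity) (by linarith) fun ψ N hψ hN ho => ?_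
  obtain ⟨C, hC1, hC, hsharp⟩ := exists_sharp_expBound hψ hN
  have hCK : C ≤ Real.exp (-δ) / (1 - δ) := by
    by_contra! hlt
    have hC1' : 1 < C := hK.trans_lt hlt
    obtain ⟨h0, h1, h2⟩ := xiPlus_spec hC1
    have hCξ : C = Real.exp (-xiPlus C) / (1 - xiPlus C) := by
      rw [h2, mul_div_cancel_right₀]; linarith
    have hδξ : δ < xiPlus C := by
      by_contra! hle
      have := exp_neg_div_le h0 hle hδ1
      rw [← hCξ] at this
      linarith
    have h3 := xiPlus_rpow_le hp hp2 hψ hN ho hC1' hC hsharp (hδ.trans hδξ.le)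
    rw [Real.mul_rpow hδ0 (by positivity), ← Real.rpow_mul hA.le, one_div_mul_cancel hp0.ne',
      Real.rpow_one] at h3
    have h4 := Real.rpow_lt_rpow hδ0 hδξ hp0
    nlinarith
  intro c d hc hcd hd
  refine (hC c d hc hcd hd).trans ?_
  have : 0 < d - c := sub_pos.2 hcd
  gcongr

theorem isJNBound_one {ε : ℝ} (hε0 : 0 ≤ ε) (hε : ε < 2 / Real.exp 1) :
    IsJNBound 1 ε (ENNReal.ofReal (kInv ε)) := by
  obtain ⟨hK1, hK⟩ := kInv_spec hε0 hε
  refine isJNBound_of_forall_bounded le_rfl hε0 (by linarith) fun ψ N hψ hN ho => ?_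
  obtain ⟨C, hC1, hC, hsharp⟩ := exists_sharp_expBound hψ hN
  have hCK : C ≤ kInv ε := by
    by_contra! hlt
    have h1 := k_le_of_oscBound hψ hN ho (hK1.trans_lt hlt) hC hsharp
    have h2 := strictMonoOn_k hK1 hC1 hlt
    linarith
  intro c d hc hcd hd
  refine (hC c d hc hcd hd).trans ?_
  have : 0 < d - c := sub_pos.2 hcd
  gcongr

theorem IsJNBound.mono {p ε ε' : ℝ} {K : ℝ≥0∞} (h : IsJNBound p ε' K) (hε : ε ≤ ε') :
    IsJNBound p ε K := fun φ hφ hn => h φ hφ (hn.trans (ENNReal.ofReal_le_ofReal hε))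

theorem logNormPow_one : logNormPow 1 = 2 / Real.exp 1 := by
  rw [logNormPow]
  have := Real.exp_pos 1
  simp only [Real.Gamma_one, sub_self, Real.rpow_zero, one_mul, integral_exp, Real.exp_zero]
  field_simp
  ring

theorem jnConst_eq {p : ℝ} (hp : 1 ≤ p) (hp2 : p ≤ 2) :
    jnConst p = ENNReal.ofReal (logNormPow p ^ (1 / p)) := by
  have hA := logNormPow_pos (show 0 < p by linarith)
  have hA' : 0 < logNormPow p ^ (1 / p) := Real.rpow_pos_of_pos hA _
  refine le_antisymm (sSup_le fun e he => ?_) (le_sSup fun ε hε0 hε => ?_)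
  · by_contra! hlt
    obtain ⟨K, hK, hJ⟩ := he _ hA'.le hlt
    exact hK.ne (eq_top_of_isJNBound hp hJ)
  · rw [ENNReal.ofReal_lt_ofReal_iff hA'] at hε
    rcases hp.eq_or_lt with rfl | hp1
    · rw [logNormPow_one, div_one, Real.rpow_one] at hε
      exact ⟨_, ENNReal.ofReal_lt_top, isJNBound_one hε0 hε⟩
    -- Only finiteness matters here, and admissible constants pass to smaller ε; so δ may be raised
    -- to 2-p, still below 1.
    · set δ := max (ε / logNormPow p ^ (1 / p)) (2 - p) with hδ
      have hδ1 : δ < 1 := max_lt ((div_lt_one hA').2 hε) (by linarith)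
      refine ⟨_, ENNReal.ofReal_lt_top,
        (isJNBound_of_one_lt hp1 hp2 (le_max_right _ _) hδ1).mono ?_⟩
      rw [← div_le_iff₀ hA']
      exact le_max_left _ _

end BMOUnitInterval

/-! ### The main theorem -/

theorem theorem1p1 :
    (∀ p : ℝ, 1 ≤ p → p ≤ 2 →
      0 < BMOUnitInterval.jnConst p ∧ BMOUnitInterval.jnConst p < ⊤ ∧
      (BMOUnitInterval.jnConst p).toReal =
        (p / Real.exp 1 * (Real.Gamma p - ∫ t in (0 : ℝ)..1, t ^ (p - 1) * Real.exp t) + 1)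
          ^ (1 / p)) ∧
    (∀ p : ℝ, 1 < p → p ≤ 2 → ∀ ε : ℝ,
      (2 - p) * (BMOUnitInterval.jnConst p).toReal ≤ ε →
      ε < (BMOUnitInterval.jnConst p).toReal →
      BMOUnitInterval.bestConst ε p =
        ENNReal.ofReal (Real.exp (-(ε / (BMOUnitInterval.jnConst p).toReal)) /
          (1 - ε / (BMOUnitInterval.jnConst p).toReal))) ∧
    Set.BijOn BMOUnitInterval.k (Set.Ici 1) (Set.Ico 0 (2 / Real.exp 1)) ∧
    (∀ ε : ℝ, 0 ≤ ε → ε < 2 / Real.exp 1 →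
      ENNReal.ofReal (Real.exp (-(Real.exp 1 / 2 * ε)) / (1 - Real.exp 1 / 2 * ε)) ≤
          BMOUnitInterval.bestConst ε 1 ∧
      BMOUnitInterval.bestConst ε 1 ≤ ENNReal.ofReal (BMOUnitInterval.kInv ε)) := by
  have hpos : ∀ p : ℝ, 1 ≤ p → 0 < BMOUnitInterval.logNormPow p ^ (1 / p) := fun p hp =>
    Real.rpow_pos_of_pos (BMOUnitInterval.logNormPow_pos (by linarith)) _
  refine ⟨fun p hp hp2 => ?_, fun p hp hp2 ε hε0 hε => ?_, BMOUnitInterval.bijOn_k,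
    fun ε hε0 hε => ⟨le_sInf fun K hK => ?_, sInf_le (BMOUnitInterval.isJNBound_one hε0 hε)⟩⟩
  · rw [BMOUnitInterval.jnConst_eq hp hp2, ENNReal.toReal_ofReal (hpos p hp).le]
    exact ⟨ENNReal.ofReal_pos.2 (hpos p hp), ENNReal.ofReal_lt_top, rfl⟩
  · rw [BMOUnitInterval.jnConst_eq hp.le hp2, ENNReal.toReal_ofReal (hpos p hp.le).le] at *
    set A := BMOUnitInterval.logNormPow p ^ (1 / p)
    have hA : 0 < A := hpos p hp.le
    set δ := ε / A with hδ
    have hεδ : ε = δ * A := (div_mul_cancel₀ ε hA.ne').symm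
    have hδ1 : δ < 1 := (div_lt_one hA).2 hε
    have hδ2 : 2 - p ≤ δ := (le_div_iff₀ hA).2 hε0
    rw [hεδ]
    exact le_antisymm (sInf_le (BMOUnitInterval.isJNBound_of_one_lt hp hp2 hδ2 hδ1))
      (le_sInf fun K hK => BMOUnitInterval.le_of_isJNBound hp.le (by linarith) hδ1 hK)
  · have he := Real.exp_pos 1
    -- The logarithm with δ = eε/2: since `logNormPow 1` = 2/e, its norm is at most ε.
    refine BMOUnitInterval.le_of_isJNBound le_rfl (by positivity) ?_ ?_
    · rw [lt_div_iff₀ he] at hε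
      linarith
    · have : Real.exp 1 / 2 * ε * BMOUnitInterval.logNormPow 1 ^ (1 / (1 : ℝ)) = ε := by
        rw [BMOUnitInterval.logNormPow_one, div_one, Real.rpow_one]
        field_simp
      rw [this]
      exact hK
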